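/- **Setting.** *Wavelets.* For $g:\mathbb R\to\mathbb R$ and $j,k\in\mathbb Z$ write $g_{jk}(x)=2^{j/2}g(2^jx-k)$. Let $s>0$, $p,q\in[1,\infty]$ and $r\in[1,\infty)$. Let $\varphi\in L^2(\mathbb R)$ be a real father wavelet: $(\varphi_{0k})_{k\in\mathbb Z}$ is orthonormal and the closed spans $V_j$ of $(\varphi_{jk})_{k\in\mathbb Z}$ are nested, $V_j\subseteq V_{j+1}$, with dense union in $L^2(\mathbb R)$. Assume that for some integer $N\ge 0$ with $s<N+1$ the function $\varphi$ has a weak derivative $\varphi^{(N+1)}$ of order $N+1$ with $\operatorname{ess\,sup}_x\sum_{k\in\mathbb Z}|\varphi^{(N+1)}(x-k)|<\infty$, and that there is a bounded non-increasing function $\Phi$ on $[0,\infty)$ with $|\varphi(u)|\le\Phi(|u|)$, $\int\Phi(|u|)\,du<\infty$ and $\int\Phi(|u|)|u|^N\,du<\infty$. Let $\psi\in L^2(\mathbb R)$ be a compactly supported real mother wavelet associated with $\varphi$, that is, $(\psi_{0k})_{k\in\mathbb Z}$ is an orthonormal basis of the orthogonal complement of $V_0$ in $V_1$. *Densities.*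 For $f\in L^1(\mathbb R)$ put $\alpha_{0k}=\int f\varphi_{0k}$, $\beta_{jk}=\int f\psi_{jk}$ and $$J_{spq}(f)=\|\alpha_{0\cdot}\|_{\ell^p}+\Big(\sum_{j\ge0}\big(2^{j(s+1/2-1/p)}\|\beta_{j\cdot}\|_{\ell^p}\big)^q\Big)^{1/q}\in[0,\infty]$$ (with the usual modification if $q=\infty$). For $L,T>0$ let $\mathcal D^s_{pq}(L,T)$ be the set of probability densities $f$ on $\mathbb R$ with $\operatorname{supp} f\subseteq[-T,T]$ and $J_{spq}(f)\le L$. *Privacy.* Let $\alpha>0$ and $n\in\mathbb N$. Given independent $X_1,\dots,X_n$ with density $f$, a channel with values in a measurable space $\mathcal Z$ releases successively $Z_i\sim Q_i(\,\cdot\mid X_i,Z_1,\dots,Z_{i-1})$, $i=1,\dots,n$, where the $Q_i$ are Markov kernels. It is locally $\alpha$-differentially private, $Q\in\mathcal Q_\alpha$, if $Q_i(A\mid x,z_1,\dots,z_{i-1})\le e^{\alpha}Q_i(A\mid x',z_1,\dots,z_{i-1})$ for all $i$, all measurable $A$, all $x,x'\in\mathbb R$ and all $z_1,\dots,z_{i-1}\in\mathcal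 Z$. An estimator $\widetilde f$ is a function of $(Z_1,\dots,Z_n)$ with values in the functions on $\mathbb R$, jointly measurable in $(z,x)\in\mathcal Z^n\times\mathbb R$. **Proposition 2.1.** Let $L,T>0$ be such that $\mathcal D^s_{pq}(L',T)\ne\emptyset$ for some $L'<L$. Then there is a constant $C>0$, not depending on $n$ and $\alpha$, such that for all $\alpha>0$ and all $n\in\mathbb N$ with $n(e^\alpha-1)^2\ge1$, $$\inf_{\widetilde f,\;Q\in\mathcal Q_\alpha}\ \sup_{f\in\mathcal D^s_{pq}(L,T)}\mathbb E_{f,Q}\|\widetilde f-f\|_r^r\ \ge\ C\,\big(n(e^\alpha-1)^2\big)^{-\frac{rs}{2s+2}},$$ where the infimum is over all measurable spaces $\mathcal Z$, all locally $\alpha$-differentially private channels $Q$ with values in $\mathcal Z$ and all estimators $\widetilde f$ based on the private views $Z_1,\dots,Z_n$. In particular, for every fixed $\alpha>0$ the bound holds for all sufficiently large $n$. -/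

import Mathlib

open MeasureTheory ProbabilityTheory
open scoped ENNReal NNReal ContDiff

universe u

noncomputable section

/-! ### Wavelets on the real line -/

/-- The dyadic dilation and translation `x ↦ 2^{j/2} g(2^j x - k)`. -/
def dyadic (g : ℝ → ℝ) (j k : ℤ) (x : ℝ) : ℝ :=
  (2 : ℝ) ^ ((j : ℝ) / 2) * g ((2 : ℝ) ^ j * x - k)

theorem memLp_dyadic {g : ℝ → ℝ} (hg : MemLp g 2 volume) (j k : ℤ) :
    MemLp (dyadic g j k) 2 volume := by
  have h2 : (2 : ℝ) ^ j ≠ 0 := zpow_ne_zero _ two_ne_zero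
  have h1 : MemLp (fun y : ℝ => g (y - k)) 2 volume :=
    hg.comp_measurePreserving (measurePreserving_sub_right volume (k : ℝ))
  have h3 : MemLp (fun y : ℝ => g (y - k)) 2 (Measure.map ((2 : ℝ) ^ j * ·) volume) := by
    rw [Real.map_volume_mul_left h2]
    exact h1.smul_measure ENNReal.ofReal_ne_top
  exact (h3.comp_of_map (by fun_prop)).const_mul _

/-- The function `2^{j/2} g(2^j · - k)` as an element of `L²(ℝ)`. -/
def dyadicL2 (g : ℝ → ℝ) (hg : MemLp g 2 volume) (j k : ℤ) : Lp ℝ 2 (volume : Measure ℝ) :=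
  (memLp_dyadic hg j k).toLp (dyadic g j k)

/-- The closed linear span in `L²(ℝ)` of the functions `2^{j/2} g(2^j · - k)`, `k ∈ ℤ`. -/
def levelSpace (g : ℝ → ℝ) (hg : MemLp g 2 volume) (j : ℤ) :
    Submodule ℝ (Lp ℝ 2 (volume : Measure ℝ)) :=
  (Submodule.span ℝ (Set.range (dyadicL2 g hg j))).topologicalClosure

/-- `φ` is a father wavelet: it generates a multiresolution analysis of `L²(ℝ)`. (That the
spaces `V_j` intersect in `{0}` is a consequence and need not be required.) -/
structure GeneratesMRA (φ : ℝ → ℝ) (hφ : MemLp φ 2 volume) : Prop where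
  orthonormal : Orthonormal ℝ (dyadicL2 φ hφ 0)
  nested : ∀ j : ℤ, levelSpace φ hφ j ≤ levelSpace φ hφ (j + 1)
  dense : (⨆ j : ℤ, levelSpace φ hφ j).topologicalClosure = ⊤

/-- `ψ` is a mother wavelet associated to the father wavelet `φ`: its integer translates are an
orthonormal basis of the orthogonal complement `W_0` of `V_0` in `V_1`. -/
structure IsMotherWavelet (φ ψ : ℝ → ℝ) (hφ : MemLp φ 2 volume) (hψ : MemLp ψ 2 volume) :
    Prop where
  orthonormal : Orthonormal ℝ (dyadicL2 ψ hψ 0)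
  span_eq : levelSpace ψ hψ 0 = levelSpace φ hφ 1 ⊓ (levelSpace φ hφ 0)ᗮ

/-- `g` is the weak derivative of order `m` of `f` on `ℝ`. -/
def HasWeakDerivOfOrder (m : ℕ) (f g : ℝ → ℝ) : Prop :=
  LocallyIntegrable f volume ∧ LocallyIntegrable g volume ∧
    ∀ η : ℝ → ℝ, ContDiff ℝ ∞ η → HasCompactSupport η →
      ∫ x, f x * iteratedDeriv m η x = (-1) ^ m * ∫ x, g x * η x

/-- The regularity and decay assumption of order `N` on the father wavelet. -/
structure FatherRegular (φ : ℝ → ℝ) (N : ℕ) : Prop where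
  weakDeriv : ∃ g : ℝ → ℝ, HasWeakDerivOfOrder (N + 1) φ g ∧
    ∃ B : ℝ≥0, ∀ᵐ x : ℝ, ∑' k : ℤ, ‖g (x - k)‖ₑ ≤ B
  decay : ∃ Φ : ℝ → ℝ, AntitoneOn Φ (Set.Ici 0) ∧ (∃ B : ℝ, ∀ u, 0 ≤ u → Φ u ≤ B) ∧
    (∀ u, |φ u| ≤ Φ |u|) ∧ Integrable (fun u : ℝ => Φ |u|) ∧
    Integrable (fun u : ℝ => Φ |u| * |u| ^ N)

/-! ### Besov classes of densities -/

/-- The wavelet coefficient `∫ f(x) 2^{j/2} g(2^j x - k) dx`. -/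
def waveletCoeff (g f : ℝ → ℝ) (j k : ℤ) : ℝ := ∫ x, f x * dyadic g j k x

/-- The Besov sequence norm
`J_{spq}(f) = ‖α_{0·}‖_p + (∑_{j ≥ 0} (2^{j(s+1/2-1/p)} ‖β_{j·}‖_p)^q)^{1/q}`, with the usual
modifications for infinite `p` or `q`: `eLpNorm` with respect to the counting measure is the
`ℓ^p`-norm, with the value `∞` for sequences outside `ℓ^p`, and `p.toReal⁻¹ = 0` for `p = ∞`. -/
def besovNorm (φ ψ : ℝ → ℝ) (s : ℝ) (p q : ℝ≥0∞) (f : ℝ → ℝ) : ℝ≥0∞ :=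
  eLpNorm (fun k : ℤ => waveletCoeff φ f 0 k) p Measure.count +
    eLpNorm (fun j : ℕ => ENNReal.ofReal ((2 : ℝ) ^ ((j : ℝ) * (s + 1 / 2 - p.toReal⁻¹))) *
      eLpNorm (fun k : ℤ => waveletCoeff ψ f j k) p Measure.count) q Measure.count

/-- The probability densities supported in `[-T, T]` with Besov norm at most `L`. -/
def densityBesov (φ ψ : ℝ → ℝ) (s : ℝ) (p q : ℝ≥0∞) (L T : ℝ) : Set (ℝ → ℝ) :=
  {f | Integrable f ∧ (∀ x, 0 ≤ f x) ∧ ∫ x, f x = 1 ∧ tsupport f ⊆ Set.Icc (-T) T ∧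
    besovNorm φ ψ s p q f ≤ ENNReal.ofReal L}

/-! ### Local differential privacy -/

/-- A (sequentially interactive) privacy channel with values in `Z`: data holder number `i`, counted
from `0`, draws `Z_i` from `Q i (x, (z_0, …, z_{i-1}))`, where `x` is the observation of
this data holder and `z_0, …, z_{i-1}` are the private views released before. -/
abbrev Channel (Z : Type u) [MeasurableSpace Z] : Type u :=
  (i : ℕ) → Kernel (ℝ × (Fin i → Z)) Z

/-- The kernels of the first `n` data holders are Markov kernels and provide local
`α`-differential privacy. -/
def IsLocallyPrivate {Z : Type u} [MeasurableSpace Z] (α : ℝ) (n : ℕ) (Q : Channel Z) : Prop :=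
  ∀ i < n, IsMarkovKernel (Q i) ∧
    ∀ (z : Fin i → Z) (x x' : ℝ) (A : Set Z), MeasurableSet A →
      Q i (x, z) A ≤ ENNReal.ofReal (Real.exp α) * Q i (x', z) A

/-- The law of the private sample `(Z_0, …, Z_{n-1})` when the observations are independent with
law `P`: given the first `n` private views `z`, the next data holder has an observation `x` with
law `P`, independent of `z`, and releases a draw `z'` from `Q n (x, z)`. -/
def privateLaw {Z : Type u} [MeasurableSpace Z] (P : Measure ℝ) (Q : Channel Z) :
    (n : ℕ) → Measure (Fin n → Z)
  | 0 => Measure.dirac (fun i => i.elim0)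
  | n + 1 => ((P.prod (privateLaw P Q n)) ⊗ₘ Q n).map
      (fun w : (ℝ × (Fin n → Z)) × Z => (Fin.snoc w.1.2 w.2 : Fin (n + 1) → Z))

/-- The probability measure on `ℝ` with density `f`. -/
def densityLaw (f : ℝ → ℝ) : Measure ℝ := volume.withDensity (fun x => ENNReal.ofReal (f x))

/-- The loss `‖f - g‖_r^r = ∫ |f(x) - g(x)|^r dx`, possibly infinite. -/
def lrLoss (r : ℝ) (f g : ℝ → ℝ) : ℝ≥0∞ := ∫⁻ x, ENNReal.ofReal (|f x - g x| ^ r)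

/-- The local `α`-differentially private minimax risk over the class `F` for the `L^r`-loss: the
infimum over all spaces `Z` of private views, all locally `α`-differentially private channels `Q`
and all estimators `fhat` based on the private views, of the maximal risk over `F`. -/
def privateMinimaxRisk (α : ℝ) (n : ℕ) (r : ℝ) (F : Set (ℝ → ℝ)) : ℝ≥0∞ :=
  ⨅ (Z : Type u) (_ : MeasurableSpace Z) (Q : Channel Z) (_ : IsLocallyPrivate α n Q)
    (fhat : (Fin n → Z) → ℝ → ℝ) (_ : Measurable (Function.uncurry fhat)),
    ⨆ f ∈ F, ∫⁻ z, lrLoss r (fhat z) f ∂(privateLaw (densityLaw f) Q n)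

end

/-! The bound comes from a hypercube of densities that private views can hardly tell apart. A base
density `b` in the interior of the class, bounded below on `[-T/2, T/2]`, is perturbed by `±γ
ψ_{jk}` for about `2^j` wavelets of one level with disjoint supports. With `γ = c 2^{-j(s+1/2)}` the
perturbation has Besov norm at most `c` for every `p` and `q`, its height is of order `2^{-js}`, and
flipping one sign moves the density in `L¹` by order `2^{-j(s+1)}`.

Privacy contracts this distance. Given the earlier views, the laws of the next view under `f` and
`f'` have a likelihood ratio within `δ = (e^α - 1)‖f - f'‖₁` of one
(`abs_integral_mul_sub_le_of_ratio_bounded`). Their chi-square divergence is thus at most `δ²`, and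
over `n` interactive steps one plus the divergence grows to at most `(1 + δ²)^n`
(`sq_lintegral_privateLaw_le`). This stays below 2 once `2^{j(2s+2)}` is of order `n(e^α - 1)²`.
Assouad's lemma (`assouad`, `le_privateMinimaxRisk_of_hypercube`) then gives a risk of order `2^j ·
2^{-jsr} · 2^{-j} = 2^{-jsr}`, which is the rate.

The analytic work lies in the base density (`exists_base_density`): a member of a smaller class is
mixed with a little of a smooth bump, whose Besov norm must be finite. That follows from the
vanishing of the moments of `ψ` up to order `N` (`moment_eq_zero`), since `s < N + 1`; the zeroth
moment also keeps the total mass of the perturbed densities equal to one. The moments vanish because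
`ψ`, lying in `V_1`, inherits a bounded weak derivative of order `N + 1` from `φ`
(`abs_integral_mul_iteratedDeriv_le`), while `ψ` is orthogonal to all finer wavelets: a first
nonzero moment would let these wavelets read off a derivative of `ψ` at all dyadic points, forcing
`ψ = 0`. -/

noncomputable section

/-! ### Chi-square closeness under local privacy -/

/-- The two hypotheses say that the density `dμ/dν` lies within `δ` of one, so its second moment
under `ν` is at most `1 + δ²`; Cauchy–Schwarz does the rest. Testing against functions is the dual
form of a chi-square bound. It tensorizes without any joint density or measurable choice of
conditional densities. -/
theorem sq_lintegral_le_of_setwise_close {Z : Type*} [MeasurableSpace Z] (μ ν : Measure Z)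
    [IsProbabilityMeasure μ] [IsProbabilityMeasure ν] (δ : ℝ≥0)
    (h1 : ∀ A, MeasurableSet A → μ A ≤ (1 + δ) * ν A)
    (h2 : ∀ A, MeasurableSet A → ν A ≤ μ A + δ * ν A)
    {g : Z → ℝ≥0∞} (hg : Measurable g) :
    (∫⁻ z, g z ∂μ) ^ 2 ≤ (1 + (δ : ℝ≥0∞) ^ 2) * ∫⁻ z, g z ^ 2 ∂ν := by
  have hac : μ ≪ ν := by
    refine Measure.AbsolutelyContinuous.mk fun A hA h0 => ?_
    have := h1 A hA
    rw [h0, mul_zero] at this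
    exact le_antisymm this zero_le
  set ρ := μ.rnDeriv ν with hρ
  have hρm : Measurable ρ := Measure.measurable_rnDeriv μ ν
  have hset : ∀ A, MeasurableSet A → ∫⁻ z in A, ρ z ∂ν = μ A := fun A hA =>
    Measure.setLIntegral_rnDeriv' hac hA
  have hup : ∀ᵐ z ∂ν, ρ z ≤ 1 + δ := by
    refine ae_le_of_forall_setLIntegral_le_of_sigmaFinite hρm fun A hA _ => ?_
    rw [hset A hA, lintegral_const, Measure.restrict_apply_univ]
    exact h1 A hA
  have hlo : ∀ᵐ z ∂ν, 1 ≤ ρ z + δ := by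
    refine ae_le_of_forall_setLIntegral_le_of_sigmaFinite measurable_const fun A hA _ => ?_
    rw [lintegral_add_right _ measurable_const, hset A hA, lintegral_const, lintegral_const,
      Measure.restrict_apply_univ, one_mul]
    exact h2 A hA
  have hsq : ∫⁻ z, ρ z ^ 2 ∂ν ≤ 1 + (δ : ℝ≥0∞) ^ 2 := by
    -- This is `(ρ - 1)² ≤ δ²`, arranged without subtraction.
    have hpt : ∀ᵐ z ∂ν, ρ z ^ 2 + 1 ≤ 2 * ρ z + (δ : ℝ≥0∞) ^ 2 := by
      filter_upwards [hup, hlo] with z hz1 hz2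
      have hfin : ρ z ≠ ⊤ := ne_top_of_le_ne_top (by simp) hz1
      lift ρ z to ℝ≥0 using hfin with t
      norm_cast at hz1 hz2 ⊢
      have e1 : (t : ℝ) ≤ 1 + δ := by exact_mod_cast hz1
      have e2 : (1 : ℝ) ≤ t + δ := by exact_mod_cast hz2
      have : (t : ℝ) ^ 2 + 1 ≤ 2 * t + δ ^ 2 := by nlinarith
      exact_mod_cast this
    have hint := lintegral_mono_ae hpt
    rw [lintegral_add_right _ measurable_const, lintegral_add_right _ measurable_const,
      lintegral_const_mul _ hρm, lintegral_const, lintegral_const, measure_univ,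
      Measure.lintegral_rnDeriv hac, measure_univ] at hint
    have h3 : ∫⁻ z, ρ z ^ 2 ∂ν + 1 ≤ (1 + (δ : ℝ≥0∞) ^ 2) + 1 := by
      calc _ ≤ _ := by simpa using hint
        _ = _ := by ring
    exact (ENNReal.add_le_add_iff_right ENNReal.one_ne_top).1 h3
  have hcs := ENNReal.lintegral_mul_le_Lp_mul_Lq ν Real.HolderConjugate.two_two
    hρm.aemeasurable hg.aemeasurable
  have hgμ : ∫⁻ z, (ρ * g) z ∂ν = ∫⁻ z, g z ∂μ :=
    lintegral_rnDeriv_mul hac hg.aemeasurable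
  rw [hgμ] at hcs
  calc (∫⁻ z, g z ∂μ) ^ 2 ≤ ((∫⁻ z, ρ z ^ (2 : ℝ) ∂ν) ^ (1 / (2 : ℝ)) *
        (∫⁻ z, g z ^ (2 : ℝ) ∂ν) ^ (1 / (2 : ℝ))) ^ 2 := by gcongr
    _ = (∫⁻ z, ρ z ^ 2 ∂ν) * ∫⁻ z, g z ^ 2 ∂ν := by
        rw [mul_pow, ← ENNReal.rpow_natCast, ← ENNReal.rpow_mul, ← ENNReal.rpow_natCast,
          ← ENNReal.rpow_mul]
        norm_num
    _ ≤ _ := by gcongr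

/-- Here `κ x` is the probability of one event given the observation `x`. As `f - f'` has integral
zero, the infimum `c` of `κ` may be subtracted from `κ`; privacy puts `κ - c` between 0 and `(e^α -
1) c`, and `c` is at most the average of `κ` under `f'`. -/
theorem abs_integral_mul_sub_le_of_ratio_bounded {α : ℝ} (hα : 0 < α) {f f' κ : ℝ → ℝ}
    (hf : Integrable f) (hf' : Integrable f') (hf0 : ∀ x, 0 ≤ f' x)
    (hi : ∫ x, f x = 1) (hi' : ∫ x, f' x = 1) (hκ : Measurable κ) (hκ0 : ∀ x, 0 ≤ κ x)
    (hκ1 : ∀ x, κ x ≤ 1) (hr : ∀ x x', κ x ≤ Real.exp α * κ x') :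
    |(∫ x, κ x * f x) - ∫ x, κ x * f' x| ≤
      (Real.exp α - 1) * (∫ x, |f x - f' x|) * ∫ x, κ x * f' x := by
  set c := ⨅ x, κ x
  have hbdd : BddBelow (Set.range κ) := ⟨0, by rintro _ ⟨x, rfl⟩; exact hκ0 x⟩
  have hc : ∀ x, c ≤ κ x := fun x => ciInf_le hbdd x
  have he : 1 < Real.exp α := by simpa using Real.one_lt_exp_iff.2 hα
  have hc0 : 0 ≤ c := le_ciInf hκ0
  have hup : ∀ x, κ x ≤ Real.exp α * c := by
    intro x
    have : (Real.exp α)⁻¹ * κ x ≤ c := le_ciInf fun x' => by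
      rw [inv_mul_le_iff₀ (by positivity)]; exact hr x x'
    rwa [inv_mul_le_iff₀ (by positivity)] at this
  have hint : ∀ {h : ℝ → ℝ}, Integrable h → Integrable (fun x => κ x * h x) := fun hh =>
    hh.bdd_mul (c := 1) hκ.aestronglyMeasurable
      (Filter.Eventually.of_forall fun x => by simpa [abs_of_nonneg (hκ0 x)] using hκ1 x)
  have hcm : c ≤ ∫ x, κ x * f' x := by
    calc c = ∫ x, c * f' x := by rw [integral_const_mul, hi', mul_one]
      _ ≤ _ := integral_mono (hf'.const_mul c) (hint hf')
        fun x => mul_le_mul_of_nonneg_right (hc x) (hf0 x)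
  have hd : Integrable (fun x => f x - f' x) := hf.sub hf'
  have e1 : (∫ x, κ x * f x) - ∫ x, κ x * f' x = ∫ x, (κ x - c) * (f x - f' x) := by
    have : ∀ x, (κ x - c) * (f x - f' x) = (κ x * f x - κ x * f' x) - c * (f x - f' x) := by
      intro x; ring
    simp_rw [this]
    have e2 := integral_sub ((hint hf).sub (hint hf')) (hd.const_mul c)
    simp only [Pi.sub_apply] at e2
    rw [e2, integral_const_mul,
      integral_sub hf hf', hi, hi', integral_sub (hint hf) (hint hf')]
    simp
  rw [e1]
  calc |∫ x, (κ x - c) * (f x - f' x)| ≤ ∫ x, |(κ x - c) * (f x - f' x)| :=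
        abs_integral_le_integral_abs
    _ ≤ ∫ x, (Real.exp α - 1) * c * |f x - f' x| := by
        refine integral_mono_of_nonneg (Filter.Eventually.of_forall fun x => abs_nonneg _)
          (hd.abs.const_mul _) (Filter.Eventually.of_forall fun x => ?_)
        simp only
        rw [abs_mul, abs_of_nonneg (sub_nonneg.2 (hc x))]
        gcongr
        linarith [hup x]
    _ = (Real.exp α - 1) * (∫ x, |f x - f' x|) * c := by rw [integral_const_mul]; ring
    _ ≤ _ := by
        gcongr

/-- The conditional law of the private view given the earlier ones. -/
def viewLaw {Z : Type*} [MeasurableSpace Z] {Y : Type*} [MeasurableSpace Y]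
    (P : Measure ℝ) (κ : Kernel (ℝ × Y) Z) (z : Y) : Measure Z :=
  P.bind fun x => κ (x, z)

/-! ### Laws of the private views -/

section

variable {Z : Type*} [MeasurableSpace Z] {Y : Type*} [MeasurableSpace Y]

theorem measurable_kernel_section (κ : Kernel (ℝ × Y) Z) (z : Y) :
    Measurable fun x : ℝ => κ (x, z) :=
  κ.measurable.comp (measurable_id.prodMk measurable_const)

theorem viewLaw_apply (P : Measure ℝ) (κ : Kernel (ℝ × Y) Z) (z : Y) {A : Set Z}
    (hA : MeasurableSet A) : viewLaw P κ z A = ∫⁻ x, κ (x, z) A ∂P :=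
  Measure.bind_apply hA (measurable_kernel_section κ z).aemeasurable

theorem lintegral_viewLaw (P : Measure ℝ) (κ : Kernel (ℝ × Y) Z) (z : Y) {g : Z → ℝ≥0∞}
    (hg : Measurable g) : ∫⁻ w, g w ∂viewLaw P κ z = ∫⁻ x, ∫⁻ w, g w ∂κ (x, z) ∂P :=
  Measure.lintegral_bind (measurable_kernel_section κ z).aemeasurable hg.aemeasurable

instance isProbabilityMeasure_viewLaw (P : Measure ℝ) [IsProbabilityMeasure P]
    (κ : Kernel (ℝ × Y) Z) [IsMarkovKernel κ] (z : Y) : IsProbabilityMeasure (viewLaw P κ z) := by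
  constructor
  rw [viewLaw_apply P κ z MeasurableSet.univ]
  simp

end

theorem isProbabilityMeasure_densityLaw {f : ℝ → ℝ} (hf : Integrable f) (h0 : ∀ x, 0 ≤ f x)
    (h1 : ∫ x, f x = 1) : IsProbabilityMeasure (densityLaw f) := by
  constructor
  rw [densityLaw, withDensity_apply _ MeasurableSet.univ, Measure.restrict_univ,
    ← ofReal_integral_eq_lintegral_ofReal hf (Filter.Eventually.of_forall h0), h1,
    ENNReal.ofReal_one]

theorem viewLaw_densityLaw_apply {Z : Type*} [MeasurableSpace Z] {Y : Type*} [MeasurableSpace Y]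
    {f : ℝ → ℝ} (hf : Integrable f) (h0 : ∀ x, 0 ≤ f x) (κ : Kernel (ℝ × Y) Z)
    [IsMarkovKernel κ] (z : Y) {A : Set Z} (hA : MeasurableSet A) :
    viewLaw (densityLaw f) κ z A = ENNReal.ofReal (∫ x, (κ (x, z) A).toReal * f x) := by
  have hm : Measurable fun x : ℝ => κ (x, z) A :=
    (κ.measurable_coe hA).comp (measurable_id.prodMk measurable_const)
  have hint : Integrable fun x => (κ (x, z) A).toReal * f x :=
    hf.bdd_mul (c := 1) hm.ennreal_toReal.aestronglyMeasurable
      (Filter.Eventually.of_forall fun x => by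
        simpa using ENNReal.toReal_mono ENNReal.one_ne_top prob_le_one)
  rw [viewLaw_apply _ _ _ hA, densityLaw, lintegral_withDensity_eq_lintegral_mul₀
    hf.aestronglyMeasurable.aemeasurable.ennreal_ofReal hm.aemeasurable,
    ofReal_integral_eq_lintegral_ofReal hint
      (Filter.Eventually.of_forall fun x => mul_nonneg ENNReal.toReal_nonneg (h0 x))]
  refine lintegral_congr fun x => ?_
  rw [Pi.mul_apply, mul_comm, ENNReal.ofReal_mul ENNReal.toReal_nonneg,
    ENNReal.ofReal_toReal (measure_ne_top _ _)]

theorem sq_lintegral_viewLaw_le {Z : Type*} [MeasurableSpace Z] {Y : Type*} [MeasurableSpace Y]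
    {α : ℝ} (hα : 0 < α) {f f' : ℝ → ℝ} (hf : Integrable f) (hf' : Integrable f')
    (h0 : ∀ x, 0 ≤ f x) (h0' : ∀ x, 0 ≤ f' x) (hi : ∫ x, f x = 1) (hi' : ∫ x, f' x = 1)
    (κ : Kernel (ℝ × Y) Z) [IsMarkovKernel κ] (z : Y)
    (hr : ∀ (x x' : ℝ) (A : Set Z), MeasurableSet A →
      κ (x, z) A ≤ ENNReal.ofReal (Real.exp α) * κ (x', z) A)
    (δ : ℝ≥0) (hδ : (Real.exp α - 1) * (∫ x, |f x - f' x|) ≤ δ)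
    {g : Z → ℝ≥0∞} (hg : Measurable g) :
    (∫⁻ w, g w ∂viewLaw (densityLaw f) κ z) ^ 2 ≤
      (1 + (δ : ℝ≥0∞) ^ 2) * ∫⁻ w, g w ^ 2 ∂viewLaw (densityLaw f') κ z := by
  have := isProbabilityMeasure_densityLaw hf h0 hi
  have := isProbabilityMeasure_densityLaw hf' h0' hi'
  have key : ∀ A, MeasurableSet A → |(∫ x, (κ (x, z) A).toReal * f x) -
      ∫ x, (κ (x, z) A).toReal * f' x| ≤ δ * ∫ x, (κ (x, z) A).toReal * f' x := by
    intro A hA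
    have hm : Measurable fun x : ℝ => (κ (x, z) A).toReal :=
      ((κ.measurable_coe hA).comp (measurable_id.prodMk measurable_const)).ennreal_toReal
    refine (abs_integral_mul_sub_le_of_ratio_bounded hα hf hf' h0' hi hi' hm
      (fun x => ENNReal.toReal_nonneg) (fun x => by
        simpa using ENNReal.toReal_mono ENNReal.one_ne_top prob_le_one) fun x x' => ?_).trans ?_
    · have := ENNReal.toReal_mono (by finiteness) (hr x x' A hA)
      rwa [ENNReal.toReal_mul, ENNReal.toReal_ofReal (Real.exp_pos _).le] at this
    · gcongr
      exact integral_nonneg fun x => mul_nonneg ENNReal.toReal_nonneg (h0' x)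
  have hδ0 : (0 : ℝ) ≤ δ := δ.coe_nonneg
  have hnn : ∀ A, 0 ≤ ∫ x, (κ (x, z) A).toReal * f' x := fun A =>
    integral_nonneg fun x => mul_nonneg ENNReal.toReal_nonneg (h0' x)
  have hnn1 : ∀ A, 0 ≤ ∫ x, (κ (x, z) A).toReal * f x := fun A =>
    integral_nonneg fun x => mul_nonneg ENNReal.toReal_nonneg (h0 x)
  refine sq_lintegral_le_of_setwise_close _ _ δ (fun A hA => ?_) (fun A hA => ?_) hg
  · rw [viewLaw_densityLaw_apply hf h0 κ z hA, viewLaw_densityLaw_apply hf' h0' κ z hA,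
      show (1 + (δ : ℝ≥0∞)) = ENNReal.ofReal (1 + δ) by
        rw [ENNReal.ofReal_add zero_le_one δ.coe_nonneg]; simp,
      ← ENNReal.ofReal_mul (by positivity)]
    refine ENNReal.ofReal_le_ofReal ?_
    linarith [(abs_le.1 (key A hA)).2]
  · rw [viewLaw_densityLaw_apply hf h0 κ z hA, viewLaw_densityLaw_apply hf' h0' κ z hA,
      show (δ : ℝ≥0∞) = ENNReal.ofReal δ by simp,
      ← ENNReal.ofReal_mul (by positivity), ← ENNReal.ofReal_add (hnn1 A)
        (mul_nonneg δ.coe_nonneg (hnn A))]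
    refine ENNReal.ofReal_le_ofReal ?_
    linarith [(abs_le.1 (key A hA)).1]

section

variable {Z : Type u} [MeasurableSpace Z]

theorem measurable_snoc_prod (n : ℕ) :
    Measurable fun w : (Fin n → Z) × Z => (Fin.snoc w.1 w.2 : Fin (n + 1) → Z) := by
  refine measurable_pi_iff.2 fun i => ?_
  refine Fin.lastCases ?_ (fun j => ?_) i
  · simpa using measurable_snd
  · simpa [Function.comp_def] using
      (measurable_pi_apply j).comp (measurable_fst (α := Fin n → Z) (β := Z))

theorem isProbabilityMeasure_privateLaw (P : Measure ℝ) [IsProbabilityMeasure P]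
    (Q : Channel Z) (n : ℕ) (hQ : ∀ i < n, IsMarkovKernel (Q i)) :
    IsProbabilityMeasure (privateLaw P Q n) := by
  induction n with
  | zero => rw [privateLaw]; infer_instance
  | succ n ih =>
    have := ih fun i hi => hQ i (hi.trans n.lt_succ_self)
    have := hQ n n.lt_succ_self
    rw [privateLaw]
    exact Measure.isProbabilityMeasure_map ((measurable_snoc_prod n).comp
      ((measurable_snd.comp measurable_fst).prodMk measurable_snd)).aemeasurable

/-- The released views are the outer variable and the last observation is integrated out, so
inductions condition on views only, never on raw data. -/
theorem lintegral_privateLaw_succ (P : Measure ℝ) [IsProbabilityMeasure P]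
    (Q : Channel Z) (n : ℕ) (hQ : ∀ i < n + 1, IsMarkovKernel (Q i))
    {g : (Fin (n + 1) → Z) → ℝ≥0∞} (hg : Measurable g) :
    ∫⁻ z, g z ∂privateLaw P Q (n + 1) =
      ∫⁻ z, ∫⁻ w, g (Fin.snoc z w) ∂viewLaw P (Q n) z ∂privateLaw P Q n := by
  have := isProbabilityMeasure_privateLaw P Q n fun i hi => hQ i (hi.trans n.lt_succ_self)
  have := hQ n n.lt_succ_self
  have hm : Measurable fun w : (ℝ × (Fin n → Z)) × Z => (Fin.snoc w.1.2 w.2 : Fin (n + 1) → Z) :=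
    (measurable_snoc_prod n).comp ((measurable_snd.comp measurable_fst).prodMk measurable_snd)
  have hgm : Measurable fun w : (ℝ × (Fin n → Z)) × Z => g (Fin.snoc w.1.2 w.2) := hg.comp hm
  rw [privateLaw, lintegral_map hg hm, Measure.lintegral_compProd hgm, lintegral_prod_symm]
  · refine lintegral_congr fun z => ?_
    rw [lintegral_viewLaw]
    exact hg.comp ((measurable_snoc_prod n).comp (measurable_const.prodMk measurable_id))
  · exact (Measurable.lintegral_kernel_prod_right (κ := Q n)
      (f := fun a w => g (Fin.snoc a.2 w)) hgm).aemeasurable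

theorem measurable_lintegral_viewLaw (P : Measure ℝ) [IsProbabilityMeasure P]
    (Q : Channel Z) (n : ℕ) [IsMarkovKernel (Q n)]
    {g : (Fin (n + 1) → Z) → ℝ≥0∞} (hg : Measurable g) :
    Measurable fun z : Fin n → Z => ∫⁻ w, g (Fin.snoc z w) ∂viewLaw P (Q n) z := by
  have hm : Measurable fun w : (ℝ × (Fin n → Z)) × Z => (Fin.snoc w.1.2 w.2 : Fin (n + 1) → Z) :=
    (measurable_snoc_prod n).comp ((measurable_snd.comp measurable_fst).prodMk measurable_snd)
  have hgm : Measurable fun w : (ℝ × (Fin n → Z)) × Z => g (Fin.snoc w.1.2 w.2) := hg.comp hm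
  have h2 := Measurable.lintegral_kernel_prod_right (κ := Q n)
      (f := fun a w => g (Fin.snoc a.2 w)) hgm
  have : (fun z : Fin n → Z => ∫⁻ w, g (Fin.snoc z w) ∂viewLaw P (Q n) z) =
      fun z => ∫⁻ x, ∫⁻ w, g (Fin.snoc z w) ∂Q n (x, z) ∂P := by
    funext z
    rw [lintegral_viewLaw]
    exact hg.comp ((measurable_snoc_prod n).comp (measurable_const.prodMk measurable_id))
  rw [this]
  exact Measurable.lintegral_prod_left (f := fun (x : ℝ) (z : Fin n → Z) =>
    ∫⁻ w, g (Fin.snoc z w) ∂Q n (x, z)) h2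

/-- The chi-square divergence between private laws tensorizes, in its dual form. -/
theorem sq_lintegral_privateLaw_le {α : ℝ} (hα : 0 < α) {f f' : ℝ → ℝ} (hf : Integrable f)
    (hf' : Integrable f') (h0 : ∀ x, 0 ≤ f x) (h0' : ∀ x, 0 ≤ f' x) (hi : ∫ x, f x = 1)
    (hi' : ∫ x, f' x = 1) (Q : Channel Z) (n : ℕ) (hQ : IsLocallyPrivate α n Q)
    (δ : ℝ≥0) (hδ : (Real.exp α - 1) * (∫ x, |f x - f' x|) ≤ δ)
    {g : (Fin n → Z) → ℝ≥0∞} (hg : Measurable g) :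
    (∫⁻ z, g z ∂privateLaw (densityLaw f) Q n) ^ 2 ≤
      (1 + (δ : ℝ≥0∞) ^ 2) ^ n * ∫⁻ z, g z ^ 2 ∂privateLaw (densityLaw f') Q n := by
  have := isProbabilityMeasure_densityLaw hf h0 hi
  have := isProbabilityMeasure_densityLaw hf' h0' hi'
  induction n with
  | zero =>
    rw [privateLaw, privateLaw, lintegral_dirac' _ hg, lintegral_dirac' _ (hg.pow_const 2)]
    simp
  | succ n ih =>
    have hM : ∀ i < n + 1, IsMarkovKernel (Q i) := fun i hi => (hQ i hi).1
    have := hM n n.lt_succ_self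
    rw [lintegral_privateLaw_succ _ Q n hM hg, lintegral_privateLaw_succ _ Q n hM (hg.pow_const 2)]
    -- The induction hypothesis is applied to the conditional mean of `g` given the first `n` views;
    -- the one-step bound is then used inside the integral over these views.
    refine (ih (fun i hi => hQ i (hi.trans n.lt_succ_self))
      (measurable_lintegral_viewLaw _ Q n hg)).trans ?_
    rw [pow_succ _ n, mul_assoc, ← lintegral_const_mul _ (measurable_lintegral_viewLaw _ Q n
      (hg.pow_const 2))]
    gcongr with z
    exact sq_lintegral_viewLaw_le hα hf hf' h0 h0' hi hi' (Q n) z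
      (fun x x' A hA => (hQ n n.lt_succ_self).2 z x x' A hA) δ hδ
      (hg.comp ((measurable_snoc_prod n).comp (measurable_const.prodMk measurable_id)))

end

/-! ### Two-point bound and Assouad's lemma -/

/-- Two hypotheses with close laws cannot both have small loss. The truncated loss `g = min (A / a)
1` acts as a randomized test: `A ≥ a g`, and `B ≥ a (1 - g) ≥ a (1 - g)²`. The square is what the
chi-square hypothesis controls. -/
theorem half_le_lintegral_add_of_sq_le {Ω : Type*} [MeasurableSpace Ω] (M M' : Measure Ω)
    [IsProbabilityMeasure M] [IsProbabilityMeasure M']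
    (hχ : ∀ h : Ω → ℝ≥0∞, Measurable h → (∫⁻ z, h z ∂M) ^ 2 ≤ 2 * ∫⁻ z, h z ^ 2 ∂M')
    {A B : Ω → ℝ≥0∞} (hA : Measurable A) {a : ℝ≥0∞} (ha : a ≠ ⊤)
    (hAB : ∀ z, a ≤ A z + B z) :
    a ≤ 2 * (∫⁻ z, A z ∂M + ∫⁻ z, B z ∂M') := by
  rcases eq_or_ne a 0 with rfl | ha0
  · exact zero_le
  set g : Ω → ℝ≥0∞ := fun z => min (A z / a) 1
  have hg : Measurable g := (hA.div_const a).min measurable_const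
  set h : Ω → ℝ≥0∞ := fun z => 1 - g z
  have hh : Measurable h := measurable_const.sub hg
  have hgh : ∀ z, g z + h z = 1 := fun z => add_tsub_cancel_of_le (min_le_right _ _)
  have hh1 : ∀ z, h z ≤ 1 := fun z => tsub_le_self
  have hAg : a * ∫⁻ z, g z ∂M ≤ ∫⁻ z, A z ∂M := by
    rw [← lintegral_const_mul _ hg]
    refine lintegral_mono fun z => ?_
    calc a * g z ≤ a * (A z / a) := by gcongr; exact min_le_left _ _
      _ = A z := ENNReal.mul_div_cancel ha0 ha
  have hBh : a * ∫⁻ z, h z ^ 2 ∂M' ≤ ∫⁻ z, B z ∂M' := by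
    rw [← lintegral_const_mul _ (hh.pow_const 2)]
    refine lintegral_mono fun z => ?_
    calc a * h z ^ 2 ≤ a * h z := by
          gcongr
          calc h z ^ 2 = h z * h z := sq _
            _ ≤ h z * 1 := by gcongr; exact hh1 z
            _ = h z := mul_one _
      _ ≤ B z := by
          rcases le_total (A z / a) 1 with hz | hz
          · simp only [h, g, min_eq_left hz]
            rw [ENNReal.mul_sub (by simp [ha]), mul_one, ENNReal.mul_div_cancel ha0 ha]
            exact tsub_le_iff_left.2 (hAB z)
          · simp [h, g, min_eq_right hz]
  have hu : ∫⁻ z, g z ∂M + ∫⁻ z, h z ∂M = 1 := by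
    rw [← lintegral_add_left hg]
    simp [hgh]
  have hv : ∫⁻ z, h z ^ 2 ∂M' ≤ 1 := by
    calc _ ≤ ∫⁻ _, 1 ∂M' := lintegral_mono fun z => pow_le_one₀ zero_le (hh1 z)
      _ = 1 := by simp
  have hχh := hχ h hh
  have key : 1 ≤ 2 * (∫⁻ z, g z ∂M + ∫⁻ z, h z ^ 2 ∂M') := by
    have f1 : ∫⁻ z, g z ∂M ≠ ⊤ := ne_top_of_le_ne_top ENNReal.one_ne_top (hu ▸ le_self_add)
    have f2 : ∫⁻ z, h z ∂M ≠ ⊤ := ne_top_of_le_ne_top ENNReal.one_ne_top (hu ▸ le_add_self)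
    have f3 := ne_top_of_le_ne_top ENNReal.one_ne_top hv
    lift ∫⁻ z, g z ∂M to ℝ≥0 using f1 with x
    lift ∫⁻ z, h z ∂M to ℝ≥0 using f2 with y
    lift ∫⁻ z, h z ^ 2 ∂M' to ℝ≥0 using f3 with w
    norm_cast at hu hχh ⊢
    have e1 : (x : ℝ) + y = 1 := by exact_mod_cast hu
    have e2 : (y : ℝ) ^ 2 ≤ 2 * w := by exact_mod_cast hχh
    -- With `x = 1 - y` and `2w ≥ y²`, the right side is at least `2 - 2y + y² = 1 + (1 - y)²`.
    have : (1 : ℝ) ≤ 2 * (x + w) := by nlinarith [sq_nonneg ((y : ℝ) - 1)]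
    exact_mod_cast this
  calc a = a * 1 := (mul_one a).symm
    _ ≤ a * (2 * (∫⁻ z, g z ∂M + ∫⁻ z, h z ^ 2 ∂M')) := by gcongr
    _ = 2 * (a * ∫⁻ z, g z ∂M + a * ∫⁻ z, h z ^ 2 ∂M') := by ring
    _ ≤ _ := by gcongr

/-- Flipping one coordinate of a sign vector. -/
def flipAt {m : ℕ} (i : Fin m) (σ : Fin m → Bool) : Fin m → Bool :=
  Function.update σ i (!σ i)

theorem flipAt_involutive {m : ℕ} (i : Fin m) : Function.Involutive (flipAt i) := by
  intro σ
  simp [flipAt]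

theorem flipAt_self {m : ℕ} (i : Fin m) (σ : Fin m → Bool) : flipAt i σ i = !σ i := by
  simp [flipAt]

theorem flipAt_of_ne {m : ℕ} {i l : Fin m} (h : l ≠ i) (σ : Fin m → Bool) :
    flipAt i σ l = σ l := by
  simp [flipAt, h]

/-- **Assouad's lemma**, in terms of chi-square closeness of neighbouring laws. -/
theorem assouad {Ω : Type*} [MeasurableSpace Ω] {m : ℕ} (M : (Fin m → Bool) → Measure Ω)
    [∀ σ, IsProbabilityMeasure (M σ)]
    (hχ : ∀ σ i, ∀ h : Ω → ℝ≥0∞, Measurable h →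
      (∫⁻ z, h z ∂M σ) ^ 2 ≤ 2 * ∫⁻ z, h z ^ 2 ∂M (flipAt i σ))
    (A : Fin m → Bool → Ω → ℝ≥0∞) (hA : ∀ i b, Measurable (A i b)) {a : ℝ≥0∞} (ha : a ≠ ⊤)
    (hAa : ∀ i z, a ≤ A i true z + A i false z) (S : ℝ≥0∞)
    (hS : ∀ σ, ∑ i, ∫⁻ z, A i (σ i) z ∂M σ ≤ S) : m * a ≤ 4 * S := by
  have hpair : ∀ i σ, a ≤ 2 * (∫⁻ z, A i (σ i) z ∂M σ +
      ∫⁻ z, A i (flipAt i σ i) z ∂M (flipAt i σ)) := by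
    intro i σ
    refine half_le_lintegral_add_of_sq_le _ _ (hχ σ i) (hA i _) ha fun z => ?_
    rw [flipAt_self]
    cases σ i
    · simpa [add_comm] using hAa i z
    · simpa using hAa i z
  have hsum : ∀ i, (2 ^ m : ℝ≥0∞) * a ≤ 4 * ∑ σ, ∫⁻ z, A i (σ i) z ∂M σ := by
    intro i
    -- Flipping permutes the cube, so both terms of the two-point bound have the same sum over `σ`;
    -- this turns the factor 2 into 4.
    have e := Equiv.sum_comp (flipAt_involutive i).toPerm fun σ => ∫⁻ z, A i (σ i) z ∂M σ
    simp only [Function.Involutive.coe_toPerm] at e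
    calc (2 ^ m : ℝ≥0∞) * a = ∑ _σ : Fin m → Bool, a := by simp
      _ ≤ ∑ σ : Fin m → Bool, 2 * (∫⁻ z, A i (σ i) z ∂M σ +
            ∫⁻ z, A i (flipAt i σ i) z ∂M (flipAt i σ)) := Finset.sum_le_sum fun σ _ => hpair i σ
      _ = 4 * ∑ σ, ∫⁻ z, A i (σ i) z ∂M σ := by
          rw [← Finset.mul_sum, Finset.sum_add_distrib, e]; ring
  have htot : (2 ^ m : ℝ≥0∞) * (m * a) ≤ 2 ^ m * (4 * S) := by
    calc (2 ^ m : ℝ≥0∞) * (m * a) = ∑ _i : Fin m, (2 ^ m : ℝ≥0∞) * a := by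
          simp; ring
      _ ≤ ∑ i : Fin m, 4 * ∑ σ, ∫⁻ z, A i (σ i) z ∂M σ := Finset.sum_le_sum fun i _ => hsum i
      _ = 4 * ∑ σ, ∑ i, ∫⁻ z, A i (σ i) z ∂M σ := by rw [← Finset.mul_sum, Finset.sum_comm]
      _ ≤ 4 * ∑ _σ : Fin m → Bool, S := by gcongr with σ; exact hS σ
      _ = 2 ^ m * (4 * S) := by simp; ring
  exact (ENNReal.mul_le_mul_iff_right (by simp) (by simp)).1 htot

/-- The sign of a bit. -/
def bitSign (b : Bool) : ℝ := if b then 1 else -1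

theorem abs_bitSign (b : Bool) : |bitSign b| = 1 := by cases b <;> simp [bitSign]

/-- The two candidate values differ by `2|h|`, so `u` is at distance at least `|h|` from one of
them. -/
theorem rpow_abs_le_add (u b h : ℝ) {r : ℝ} (hr : 0 ≤ r) :
    |h| ^ r ≤ |u - (b + bitSign true * h)| ^ r + |u - (b + bitSign false * h)| ^ r := by
  have h1 : |h| ≤ max |u - (b + bitSign true * h)| |u - (b + bitSign false * h)| := by
    have e : 2 * |h| = |(u - (b + bitSign false * h)) - (u - (b + bitSign true * h))| := by
      rw [← abs_two, ← abs_mul]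
      simp only [bitSign, if_true, Bool.false_eq_true, if_false]
      congr 1
      ring
    have := abs_sub (u - (b + bitSign false * h)) (u - (b + bitSign true * h))
    rw [le_max_iff]
    by_contra! hc
    linarith [hc.1, hc.2]
  rcases le_max_iff.1 h1 with h2 | h2
  · exact (Real.rpow_le_rpow (abs_nonneg _) h2 hr).trans (le_add_of_nonneg_right (by positivity))
  · exact (Real.rpow_le_rpow (abs_nonneg _) h2 hr).trans (le_add_of_nonneg_left (by positivity))

/-- Lower bound for the private minimax risk over a class containing a hypercube of densities. -/
theorem le_privateMinimaxRisk_of_hypercube {α : ℝ} (hα : 0 < α) (n : ℕ) {r : ℝ} (hr : 0 ≤ r)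
    (F : Set (ℝ → ℝ)) {m : ℕ} (f : (Fin m → Bool) → ℝ → ℝ) (hfF : ∀ σ, f σ ∈ F)
    (hfi : ∀ σ, Integrable (f σ)) (hf0 : ∀ σ x, 0 ≤ f σ x) (hf1 : ∀ σ, ∫ x, f σ x = 1)
    (I : Fin m → Set ℝ) (hI : ∀ i, MeasurableSet (I i))
    (hdisj : Pairwise (Function.onFun Disjoint I))
    (b : ℝ → ℝ) (hb : Measurable b) (h : Fin m → ℝ → ℝ) (hh : ∀ i, Measurable (h i))
    (hfI : ∀ σ i, ∀ x ∈ I i, f σ x = b x + bitSign (σ i) * h i x)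
    (δ : ℝ≥0) (hδ : ∀ σ i, (Real.exp α - 1) * (∫ x, |f σ x - f (flipAt i σ) x|) ≤ δ)
    (hδn : (1 + (δ : ℝ≥0∞) ^ 2) ^ n ≤ 2) {a : ℝ≥0∞} (ha : a ≠ ⊤)
    (hah : ∀ i, a ≤ ∫⁻ x in I i, ENNReal.ofReal (|h i x| ^ r)) :
    m * a ≤ 4 * privateMinimaxRisk.{u} α n r F := by
  have hr4 : ∀ S : ℝ≥0∞, m * a ≤ 4 * S ↔ m * a / 4 ≤ S := fun S => by
    rw [ENNReal.div_le_iff_le_mul (by simp) (by simp), mul_comm 4 S]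
  rw [hr4, privateMinimaxRisk]
  refine le_iInf fun Z => le_iInf fun mZ => le_iInf fun Q => le_iInf fun hQ =>
    le_iInf fun fhat => le_iInf fun hfm => ?_
  rw [← hr4]
  have hP : ∀ σ, IsProbabilityMeasure (densityLaw (f σ)) := fun σ =>
    isProbabilityMeasure_densityLaw (hfi σ) (hf0 σ) (hf1 σ)
  have hM : ∀ σ, IsProbabilityMeasure (privateLaw (densityLaw (f σ)) Q n) := fun σ =>
    isProbabilityMeasure_privateLaw _ Q n fun i hi => (hQ i hi).1
  have hmeas : ∀ i b', Measurable fun w : (Fin n → Z) × ℝ =>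
      ENNReal.ofReal (|fhat w.1 w.2 - (b w.2 + bitSign b' * h i w.2)| ^ r) := by
    intro i b'
    refine ENNReal.measurable_ofReal.comp (Measurable.pow_const ?_ r)
    refine (Measurable.sub hfm ?_).abs
    exact (hb.comp measurable_snd).add (((hh i).comp measurable_snd).const_mul _)
  refine assouad (fun σ => privateLaw (densityLaw (f σ)) Q n) (fun σ i g hg => ?_)
    (fun i b' z => ∫⁻ x in I i, ENNReal.ofReal (|fhat z x - (b x + bitSign b' * h i x)| ^ r))
    (fun i b' => ?_) ha (fun i z => ?_) _ fun σ => ?_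
  · exact (sq_lintegral_privateLaw_le hα (hfi σ) (hfi _) (hf0 σ) (hf0 _) (hf1 σ) (hf1 _) Q n hQ δ
      (hδ σ i) hg).trans (by gcongr)
  · exact (hmeas i b').lintegral_prod_right'
  · refine (hah i).trans ?_
    have hz : Measurable fun x =>
        ENNReal.ofReal (|fhat z x - (b x + bitSign true * h i x)| ^ r) :=
      (hmeas i true).comp measurable_prodMk_left
    rw [← lintegral_add_left hz]
    refine lintegral_mono fun x => ?_
    rw [← ENNReal.ofReal_add (by positivity) (by positivity)]
    exact ENNReal.ofReal_le_ofReal (rpow_abs_le_add _ _ _ hr)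
  -- Only the loss inside the disjoint cells is kept. On the cell `I i` the density depends on `σ`
  -- through `σ i` alone, so the total loss dominates a sum of coordinatewise losses.
  · rw [← lintegral_finsetSum _ fun i _ => (hmeas i (σ i)).lintegral_prod_right']
    refine le_iSup₂_of_le (f σ) (hfF σ) (lintegral_mono fun z => ?_)
    calc ∑ i, ∫⁻ x in I i, ENNReal.ofReal (|fhat z x - (b x + bitSign (σ i) * h i x)| ^ r)
        = ∑ i, ∫⁻ x in I i, ENNReal.ofReal (|fhat z x - f σ x| ^ r) := by
          refine Finset.sum_congr rfl fun i _ => setLIntegral_congr_fun (hI i) fun x hx => ?_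
          simp only [hfI σ i x hx]
      _ = ∫⁻ x in ⋃ i, I i, ENNReal.ofReal (|fhat z x - f σ x| ^ r) := by
          rw [lintegral_iUnion hI hdisj, tsum_fintype]
      _ ≤ lrLoss r (fhat z) (f σ) := setLIntegral_le_lintegral _ _

/-! ### Dyadic dilations and orthogonality between levels -/

theorem quasiMeasurePreserving_dyadic (j k : ℤ) :
    Measure.QuasiMeasurePreserving (fun x : ℝ => (2 : ℝ) ^ j * x - k) volume volume := by
  have h2 : (2 : ℝ) ^ j ≠ 0 := zpow_ne_zero _ two_ne_zero
  have h1 : Measure.QuasiMeasurePreserving (fun x : ℝ => (2 : ℝ) ^ j * x) volume volume := by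
    refine ⟨by fun_prop, ?_⟩
    rw [Real.map_volume_mul_left h2]
    exact Measure.smul_absolutelyContinuous
  exact (measurePreserving_sub_right volume (k : ℝ)).quasiMeasurePreserving.comp h1

theorem dyadic_congr_ae {g g' : ℝ → ℝ} (h : g =ᵐ[volume] g') (j k : ℤ) :
    dyadic g j k =ᵐ[volume] dyadic g' j k := by
  have := (quasiMeasurePreserving_dyadic j k).ae_eq_comp h
  filter_upwards [this] with x hx
  simp only [Function.comp_apply] at hx
  simp only [dyadic, hx]

theorem dyadic_dyadic (g : ℝ → ℝ) (i j k : ℤ) :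
    dyadic (dyadic g i k) j 0 = dyadic g (i + j) k := by
  funext x
  simp only [dyadic, Int.cast_zero, sub_zero, Int.cast_add, add_div]
  rw [Real.rpow_add two_pos, zpow_add₀ two_ne_zero, ← mul_assoc, ← mul_assoc,
    mul_comm ((2 : ℝ) ^ ((j : ℝ) / 2))]

theorem two_rpow_half_mul_self (j : ℤ) :
    (2 : ℝ) ^ ((j : ℝ) / 2) * (2 : ℝ) ^ ((j : ℝ) / 2) = (2 : ℝ) ^ j := by
  rw [← Real.rpow_add two_pos, add_halves, Real.rpow_intCast]

theorem integral_comp_dyadic (F : ℝ → ℝ) (j k : ℤ) :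
    ∫ x, F ((2 : ℝ) ^ j * x - k) = ((2 : ℝ) ^ j)⁻¹ * ∫ y, F y := by
  have := Measure.integral_comp_mul_left (fun y => F (y - k)) ((2 : ℝ) ^ j)
  rw [this, integral_sub_right_eq_self F (k : ℝ), abs_of_pos (by positivity), smul_eq_mul]

theorem integral_dyadic_mul_dyadic (g h : ℝ → ℝ) (j : ℤ) :
    ∫ x, dyadic g j 0 x * dyadic h j 0 x = ∫ y, g y * h y := by
  have h2 : (2 : ℝ) ^ j ≠ 0 := zpow_ne_zero _ two_ne_zero
  calc ∫ x, dyadic g j 0 x * dyadic h j 0 x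
      = ∫ x, (2 : ℝ) ^ j * (fun y => g y * h y) ((2 : ℝ) ^ j * x - (0 : ℤ)) := by
        refine integral_congr_ae (Filter.Eventually.of_forall fun x => ?_)
        simp only [dyadic, ← two_rpow_half_mul_self j]
        ring
    _ = _ := by
        rw [integral_const_mul, integral_comp_dyadic (fun y => g y * h y), mul_inv_cancel_left₀ h2]

theorem inner_toLp_eq_integral {f g : ℝ → ℝ} (hf : MemLp f 2 volume) (hg : MemLp g 2 volume) :
    inner ℝ (hf.toLp f) (hg.toLp g) = ∫ x, f x * g x := by
  rw [L2.inner_def]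
  refine integral_congr_ae ?_
  filter_upwards [hf.coeFn_toLp, hg.coeFn_toLp] with x h1 h2
  rw [h1, h2]
  simp [mul_comm]

theorem inner_dyadicL2 {g h : ℝ → ℝ} (hg : MemLp g 2 volume) (hh : MemLp h 2 volume)
    (j k j' k' : ℤ) : inner ℝ (dyadicL2 g hg j k) (dyadicL2 h hh j' k') =
      ∫ x, dyadic g j k x * dyadic h j' k' x :=
  inner_toLp_eq_integral _ _

theorem dyadicL2_congr {g g' : ℝ → ℝ} (hg : MemLp g 2 volume) (hg' : MemLp g' 2 volume)
    (h : g =ᵐ[volume] g') (j k : ℤ) : dyadicL2 g hg j k = dyadicL2 g' hg' j k :=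
  (MemLp.toLp_eq_toLp_iff _ _).2 (dyadic_congr_ae h j k)

/-- The unitary dilation `f ↦ 2^{j/2} f(2^j ·)` of `L²(ℝ)`. -/
def dilation (j : ℤ) :
    Lp ℝ 2 (volume : Measure ℝ) →ₗᵢ[ℝ] Lp ℝ 2 (volume : Measure ℝ) where
  toFun f := dyadicL2 f (Lp.memLp f) j 0
  map_add' f g := by
    rw [dyadicL2, dyadicL2, dyadicL2, ← MemLp.toLp_add]
    refine (MemLp.toLp_eq_toLp_iff _ _).2 ((dyadic_congr_ae (Lp.coeFn_add f g) j 0).trans ?_)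
    refine Filter.Eventually.of_forall fun x => ?_
    simp [dyadic, mul_add]
  map_smul' c f := by
    rw [dyadicL2, dyadicL2, RingHom.id_apply, ← MemLp.toLp_const_smul]
    refine (MemLp.toLp_eq_toLp_iff _ _).2 ((dyadic_congr_ae (Lp.coeFn_smul c f) j 0).trans ?_)
    refine Filter.Eventually.of_forall fun x => ?_
    simp [dyadic]
    ring
  norm_map' f := by
    have h : ‖dyadicL2 f (Lp.memLp f) j 0‖ ^ 2 = ‖f‖ ^ 2 := by
      rw [← real_inner_self_eq_norm_sq, ← real_inner_self_eq_norm_sq, inner_dyadicL2,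
        integral_dyadic_mul_dyadic]
      conv_rhs => rw [← Lp.toLp_coeFn f (Lp.memLp f)]
      rw [inner_toLp_eq_integral]
    exact (sq_eq_sq₀ (norm_nonneg _) (norm_nonneg _)).1 h

theorem dilation_dyadicL2 {g : ℝ → ℝ} (hg : MemLp g 2 volume) (i j k : ℤ) :
    dilation j (dyadicL2 g hg i k) = dyadicL2 g hg (i + j) k := by
  change dyadicL2 (dyadicL2 g hg i k) (Lp.memLp _) j 0 = _
  have h : (dyadicL2 g hg i k : ℝ → ℝ) =ᵐ[volume] dyadic g i k := MemLp.coeFn_toLp _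
  rw [dyadicL2_congr _ (memLp_dyadic hg i k) h j 0]
  simp only [dyadicL2, dyadic_dyadic]

theorem dyadicL2_mem_levelSpace {g : ℝ → ℝ} (hg : MemLp g 2 volume) (j k : ℤ) :
    dyadicL2 g hg j k ∈ levelSpace g hg j :=
  Submodule.le_topologicalClosure _ (Submodule.subset_span ⟨k, rfl⟩)

theorem dilation_mem_levelSpace {g : ℝ → ℝ} (hg : MemLp g 2 volume) (i j : ℤ)
    {f : Lp ℝ 2 (volume : Measure ℝ)} (hf : f ∈ levelSpace g hg i) :
    dilation j f ∈ levelSpace g hg (i + j) := by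
  refine map_mem_closure (dilation j).continuous hf fun x hx => ?_
  have : (Submodule.span ℝ (Set.range (dyadicL2 g hg i))) ≤
      (Submodule.span ℝ (Set.range (dyadicL2 g hg (i + j)))).comap (dilation j).toLinearMap := by
    rw [Submodule.span_le]
    rintro _ ⟨k, rfl⟩
    exact Submodule.subset_span ⟨k, (dilation_dyadicL2 hg i j k).symm⟩
  exact this hx

theorem orthonormal_dyadicL2 {g : ℝ → ℝ} {hg : MemLp g 2 volume}
    (h : Orthonormal ℝ (dyadicL2 g hg 0)) (j : ℤ) : Orthonormal ℝ (dyadicL2 g hg j) := by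
  have := h.comp_linearIsometry (dilation j)
  convert this using 1
  funext k
  simp [dilation_dyadicL2]

section

variable {φ ψ : ℝ → ℝ} {hφ : MemLp φ 2 volume} {hψ : MemLp ψ 2 volume}

theorem GeneratesMRA.levelSpace_mono (h : GeneratesMRA φ hφ) : Monotone (levelSpace φ hφ) :=
  monotone_int_of_le_succ h.nested

theorem IsMotherWavelet.mem_levelSpace (h : IsMotherWavelet φ ψ hφ hψ) (j k : ℤ) :
    dyadicL2 ψ hψ j k ∈ levelSpace φ hφ (j + 1) := by
  have h0 : dyadicL2 ψ hψ 0 k ∈ levelSpace φ hφ 1 ⊓ (levelSpace φ hφ 0)ᗮ :=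
    h.span_eq ▸ dyadicL2_mem_levelSpace hψ 0 k
  have := dilation_mem_levelSpace hφ 1 j h0.1
  rwa [dilation_dyadicL2, zero_add, add_comm] at this

/-- The dilation is an isometry moving level 0 to level `j`, so the relation `W_0 ⊥ V_0` is
transported. Checking the generators of `V_j` is enough because an orthogonal complement is closed.
-/
theorem IsMotherWavelet.inner_eq_zero (h : IsMotherWavelet φ ψ hφ hψ) (j k : ℤ)
    {v : Lp ℝ 2 (volume : Measure ℝ)} (hv : v ∈ levelSpace φ hφ j) :
    inner ℝ v (dyadicL2 ψ hψ j k) = 0 := by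
  have h0 : dyadicL2 ψ hψ 0 k ∈ levelSpace φ hφ 1 ⊓ (levelSpace φ hφ 0)ᗮ :=
    h.span_eq ▸ dyadicL2_mem_levelSpace hψ 0 k
  have hle : levelSpace φ hφ j ≤ (Submodule.span ℝ {dyadicL2 ψ hψ j k})ᗮ := by
    refine Submodule.topologicalClosure_minimal _ ?_ (Submodule.isClosed_orthogonal _)
    rw [Submodule.span_le]
    rintro _ ⟨m, rfl⟩
    rw [SetLike.mem_coe, Submodule.mem_orthogonal_singleton_iff_inner_left]
    have e1 : dyadicL2 φ hφ j m = dilation j (dyadicL2 φ hφ 0 m) := by simp [dilation_dyadicL2]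
    have e2 : dyadicL2 ψ hψ j k = dilation j (dyadicL2 ψ hψ 0 k) := by simp [dilation_dyadicL2]
    rw [e1, e2, LinearIsometry.inner_map_map]
    exact (Submodule.mem_orthogonal _ _).1 h0.2 _ (dyadicL2_mem_levelSpace hφ 0 m)
  exact Submodule.mem_orthogonal_singleton_iff_inner_left.1 (hle hv)

theorem IsMotherWavelet.integral_mul_father (hM : GeneratesMRA φ hφ)
    (h : IsMotherWavelet φ ψ hφ hψ) {i j : ℤ} (hij : i ≤ j) (k k' : ℤ) :
    ∫ x, dyadic ψ j k x * dyadic φ i k' x = 0 := by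
  rw [← inner_dyadicL2 hψ hφ, real_inner_comm]
  exact h.inner_eq_zero j k (hM.levelSpace_mono hij (dyadicL2_mem_levelSpace hφ i k'))

/-- For `j' < j` the coarser wavelet lies in `V_{j'+1} ⊆ V_j`, to which the finer one is orthogonal.
-/
theorem IsMotherWavelet.integral_mul_of_ne (hM : GeneratesMRA φ hφ)
    (h : IsMotherWavelet φ ψ hφ hψ) {j j' : ℤ} (hj : j ≠ j') (k k' : ℤ) :
    ∫ x, dyadic ψ j k x * dyadic ψ j' k' x = 0 := by
  wlog hlt : j' < j generalizing j j' k k'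
  · simp_rw [mul_comm (dyadic ψ j k _)]
    exact this hj.symm k' k (lt_of_le_of_ne (not_lt.1 hlt) hj)
  rw [← inner_dyadicL2 hψ hψ, real_inner_comm]
  exact h.inner_eq_zero j k (hM.levelSpace_mono (by omega) (h.mem_levelSpace j' k'))

theorem IsMotherWavelet.integral_mul_self_level (h : IsMotherWavelet φ ψ hφ hψ) (j k k' : ℤ) :
    ∫ x, dyadic ψ j k x * dyadic ψ j k' x = if k = k' then 1 else 0 := by
  rw [← inner_dyadicL2 hψ hψ]
  exact orthonormal_iff_ite.1 (orthonormal_dyadicL2 h.orthonormal j) k k'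

end

/-! ### The bounded weak derivative of the mother wavelet -/

theorem contDiff_iteratedDeriv_of_smooth {η : ℝ → ℝ} (hη : ContDiff ℝ ∞ η) (m : ℕ) :
    ContDiff ℝ ∞ (iteratedDeriv m η) := by
  rw [iteratedDeriv_eq_iterate]
  exact hη.iterate_deriv m

theorem hasCompactSupport_iteratedDeriv {η : ℝ → ℝ} (hη : HasCompactSupport η) (m : ℕ) :
    HasCompactSupport (iteratedDeriv m η) := by
  induction m with
  | zero => simpa using hη
  | succ m ih => rw [iteratedDeriv_succ]; exact ih.deriv

theorem hasDerivAt_iteratedDeriv {η : ℝ → ℝ} (hη : ContDiff ℝ ∞ η) (m : ℕ) (x : ℝ) :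
    HasDerivAt (iteratedDeriv m η) (iteratedDeriv (m + 1) η x) x := by
  rw [iteratedDeriv_succ]
  exact ((contDiff_iteratedDeriv_of_smooth hη m).differentiable (by simp) x).hasDerivAt

theorem HasWeakDerivOfOrder.integral_dyadic_one {m : ℕ} {f G : ℝ → ℝ}
    (h : HasWeakDerivOfOrder m f G) {η : ℝ → ℝ} (hη : ContDiff ℝ ∞ η)
    (hc : HasCompactSupport η) (k : ℤ) :
    ∫ x, dyadic f 1 k x * iteratedDeriv m η x =
      (-1) ^ m * (2 ^ m * ∫ x, dyadic G 1 k x * η x) := by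
  set θ : ℝ → ℝ := fun y => η (2⁻¹ * (y + k)) with hθ
  have hθs : ContDiff ℝ ∞ θ := hη.comp (by fun_prop)
  have hθc : HasCompactSupport θ := by
    have : θ = η ∘ ((Homeomorph.addRight (k : ℝ)).trans
        (Homeomorph.mulLeft₀ (2⁻¹ : ℝ) (by norm_num))) := by
      funext y; simp [hθ]
    rw [this]
    exact hc.comp_homeomorph _
  have hder : ∀ y, iteratedDeriv m θ y = (2⁻¹) ^ m * iteratedDeriv m η (2⁻¹ * (y + k)) := by
    intro y
    have h1 : iteratedDeriv m (fun y => η (2⁻¹ * y)) =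
        fun y => (2⁻¹) ^ m * iteratedDeriv m η (2⁻¹ * y) :=
      iteratedDeriv_comp_const_mul (hη.of_le (by exact_mod_cast le_top)) _
    have h2 := iteratedDeriv_comp_add_const (n := m) (f := fun y => η (2⁻¹ * y)) (s := (k : ℝ))
    rw [hθ, h2, h1]
  have key := h.2.2 θ hθs hθc
  have e1 : ∀ x, dyadic f 1 k x * iteratedDeriv m η x = (2 : ℝ) ^ (((1 : ℤ) : ℝ) / 2) * 2 ^ m *
      (fun y => f y * iteratedDeriv m θ y) ((2 : ℝ) ^ (1 : ℤ) * x - k) := by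
    intro x
    simp only [dyadic, hder, zpow_one]
    have : (2⁻¹ : ℝ) * (2 * x - k + k) = x := by ring
    rw [this, inv_pow]
    field_simp
  have e2 : ∀ x, dyadic G 1 k x * η x = (2 : ℝ) ^ (((1 : ℤ) : ℝ) / 2) *
      (fun y => G y * θ y) ((2 : ℝ) ^ (1 : ℤ) * x - k) := by
    intro x
    simp only [dyadic, hθ, zpow_one]
    have : (2⁻¹ : ℝ) * (2 * x - k + k) = x := by ring
    rw [this, mul_assoc]
  simp_rw [e1, e2]
  rw [integral_const_mul, integral_const_mul,
    integral_comp_dyadic (fun y => f y * iteratedDeriv m θ y),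
    integral_comp_dyadic (fun y => G y * θ y), key]
  ring

/-- In dual form: the weak derivative of order `m` of `ψ` is bounded. For a finite combination of
the `φ_{1k}` the coefficients are at most its norm by orthonormality, and the sum of the translates
of `|G|` is bounded. The resulting estimate involves only the `L²` norm, hence passes to the closure
`V_1`, which contains `ψ`. -/
theorem abs_integral_mul_iteratedDeriv_le {φ ψ : ℝ → ℝ} {hφ : MemLp φ 2 volume}
    {hψ : MemLp ψ 2 volume} (hMRA : GeneratesMRA φ hφ) (hmother : IsMotherWavelet φ ψ hφ hψ)
    {m : ℕ} {G : ℝ → ℝ} (hG : HasWeakDerivOfOrder m φ G) {B : ℝ≥0}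
    (hB : ∀ᵐ x : ℝ, ∑' k : ℤ, ‖G (x - k)‖ₑ ≤ B) :
    ∃ K : ℝ, ∀ η : ℝ → ℝ, ContDiff ℝ ∞ η → HasCompactSupport η →
      |∫ x, ψ x * iteratedDeriv m η x| ≤ K * ∫ x, |η x| := by
  set q : ℝ := (2 : ℝ) ^ (((1 : ℤ) : ℝ) / 2) with hq
  have hq0 : 0 ≤ q := by positivity
  have hBS : ∀ᵐ x : ℝ, ∀ S : Finset ℤ, ∑ k ∈ S, |dyadic G 1 k x| ≤ q * B := by
    have h1 := (quasiMeasurePreserving_dyadic 1 0).ae hB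
    filter_upwards [h1] with x hx S
    have h2 : (∑ k ∈ S, ‖G ((2 : ℝ) ^ (1 : ℤ) * x - (0 : ℤ) - k)‖ₑ) ≤ B :=
      (ENNReal.sum_le_tsum S).trans hx
    have h3 : ∑ k ∈ S, |G ((2 : ℝ) ^ (1 : ℤ) * x - k)| ≤ B := by
      have h4 := ENNReal.toReal_mono ENNReal.coe_ne_top h2
      rw [ENNReal.toReal_sum (fun k _ => enorm_ne_top)] at h4
      simpa using h4
    calc ∑ k ∈ S, |dyadic G 1 k x| = q * ∑ k ∈ S, |G ((2 : ℝ) ^ (1 : ℤ) * x - k)| := by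
          rw [Finset.mul_sum]
          refine Finset.sum_congr rfl fun k _ => ?_
          rw [dyadic, abs_mul, abs_of_nonneg hq0]
      _ ≤ q * B := by gcongr
  have hGm : ∀ k, AEStronglyMeasurable (dyadic G 1 k) volume := fun k =>
    (hG.2.1.aestronglyMeasurable.comp_quasiMeasurePreserving
      (quasiMeasurePreserving_dyadic 1 k)).const_mul _
  refine ⟨2 ^ m * (q * B), fun η hη hc => ?_⟩
  have hηi : Integrable η := hη.continuous.integrable_of_hasCompactSupport hc
  have hGη : ∀ k, Integrable fun x => dyadic G 1 k x * η x := fun k =>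
    hηi.bdd_mul (c := q * B) (hGm k) (by
      filter_upwards [hBS] with x hx
      simpa using hx {k})
  have hsm : ContDiff ℝ ∞ (iteratedDeriv m η) := contDiff_iteratedDeriv_of_smooth hη m
  have hHc : HasCompactSupport (iteratedDeriv m η) := hasCompactSupport_iteratedDeriv hc m
  have hH : MemLp (iteratedDeriv m η) 2 volume := hsm.continuous.memLp_of_hasCompactSupport hHc
  set H := hH.toLp _
  have horth := orthonormal_dyadicL2 hMRA.orthonormal 1
  -- For fixed `η` both sides are continuous in `f`, so the estimate survives `L²` limits.
  have hclosed : IsClosed {f : Lp ℝ 2 (volume : Measure ℝ) |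
      |inner ℝ f H| ≤ 2 ^ m * (q * B) * (∫ x, |η x|) * ‖f‖} :=
    isClosed_le (by fun_prop) (by fun_prop)
  have hspan : (Submodule.span ℝ (Set.range (dyadicL2 φ hφ 1)) : Set (Lp ℝ 2 volume)) ⊆
      {f : Lp ℝ 2 (volume : Measure ℝ) |
        |inner ℝ f H| ≤ 2 ^ m * (q * B) * (∫ x, |η x|) * ‖f‖} := by
    intro f hf
    obtain ⟨c, rfl⟩ := Finsupp.mem_span_range_iff_exists_finsupp.1 hf
    rw [Finsupp.sum]
    set f := ∑ k ∈ c.support, c k • dyadicL2 φ hφ 1 k with hfdef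
    have hck : ∀ k ∈ c.support, |c k| ≤ ‖f‖ := by
      intro k hk
      have h1 : inner ℝ (dyadicL2 φ hφ 1 k) f = c k := horth.inner_right_sum c hk
      rw [← h1]
      calc |inner ℝ (dyadicL2 φ hφ 1 k) f| ≤ ‖dyadicL2 φ hφ 1 k‖ * ‖f‖ :=
            abs_real_inner_le_norm _ _
        _ = ‖f‖ := by rw [horth.1 k, one_mul]
    have hterm : ∀ k, inner ℝ (dyadicL2 φ hφ 1 k) H =
        (-1) ^ m * (2 ^ m * ∫ x, dyadic G 1 k x * η x) := fun k => by
      rw [← hG.integral_dyadic_one hη hc k]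
      exact inner_toLp_eq_integral _ _
    have hin : inner ℝ f H =
        ∑ k ∈ c.support, c k * ((-1) ^ m * (2 ^ m * ∫ x, dyadic G 1 k x * η x)) := by
      rw [hfdef, sum_inner]
      refine Finset.sum_congr rfl fun k _ => ?_
      rw [real_inner_smul_left, hterm]
    change |inner ℝ f H| ≤ _
    calc |inner ℝ f H| ≤ ∑ k ∈ c.support, ‖f‖ * (2 ^ m * ∫ x, |dyadic G 1 k x| * |η x|) := by
          rw [hin]
          refine (Finset.abs_sum_le_sum_abs _ _).trans (Finset.sum_le_sum fun k hk => ?_)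
          rw [abs_mul, abs_mul, abs_mul, abs_pow, abs_neg, abs_one, one_pow, one_mul,
            abs_of_nonneg (by positivity : (0 : ℝ) ≤ 2 ^ m)]
          have := abs_integral_le_integral_abs (f := fun x => dyadic G 1 k x * η x)
            (μ := volume)
          simp_rw [abs_mul] at this
          gcongr
          exact hck k hk
      _ = ‖f‖ * 2 ^ m * ∫ x, (∑ k ∈ c.support, |dyadic G 1 k x|) * |η x| := by
          simp_rw [Finset.sum_mul]
          rw [integral_finsetSum _ fun k _ => by simpa [abs_mul] using (hGη k).abs, Finset.mul_sum]
          refine Finset.sum_congr rfl fun k _ => by ring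
      _ ≤ ‖f‖ * 2 ^ m * ∫ x, (q * B) * |η x| := by
          refine mul_le_mul_of_nonneg_left (integral_mono_of_nonneg
            (Filter.Eventually.of_forall fun x => by positivity) (hηi.abs.const_mul _) ?_)
            (by positivity)
          filter_upwards [hBS] with x hx
          exact mul_le_mul_of_nonneg_right (hx _) (abs_nonneg _)
      _ = _ := by rw [integral_const_mul]; ring
  have hmem : dyadicL2 ψ hψ 0 0 ∈ levelSpace φ hφ 1 := by
    simpa using hmother.mem_levelSpace 0 0
  have hfin := closure_minimal hspan hclosed hmem
  have hnorm : ‖dyadicL2 ψ hψ 0 0‖ = 1 := hmother.orthonormal.1 0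
  have hψ0 : dyadic ψ 0 0 = ψ := by funext x; simp [dyadic]
  have hinner : inner ℝ (dyadicL2 ψ hψ 0 0) H = ∫ x, ψ x * iteratedDeriv m η x := by
    rw [dyadicL2, inner_toLp_eq_integral, hψ0]
  simpa [hnorm, hinner] using hfin

/-! ### Taylor expansions and moments -/

theorem abs_sub_taylor_le {h : ℝ → ℝ} (hh : ContDiff ℝ ∞ h) {l : ℕ} {C : ℝ}
    (hC : ∀ x, |iteratedDeriv (l + 1) h x| ≤ C) (x₀ t : ℝ) :
    |h (x₀ + t) - ∑ i ∈ Finset.range (l + 1), iteratedDeriv i h x₀ * t ^ i / i.factorial| ≤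
      C * |t| ^ (l + 1) := by
  have hC0 : 0 ≤ C := (abs_nonneg _).trans (hC 0)
  rcases eq_or_ne t 0 with rfl | ht
  · rw [Finset.sum_eq_single 0]
    · simp
    · intro i _ hi
      simp [hi]
    · simp
  have hne : x₀ ≠ x₀ + t := by simpa using ht
  obtain ⟨x', _, hx'⟩ := taylor_mean_remainder_lagrange_iteratedDeriv (n := l) hne
    (hh.of_le (by exact_mod_cast le_top)).contDiffOn
  have hsum : taylorWithinEval h l (Set.uIcc x₀ (x₀ + t)) x₀ (x₀ + t) =
      ∑ i ∈ Finset.range (l + 1), iteratedDeriv i h x₀ * t ^ i / i.factorial := by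
    rw [taylor_within_apply]
    refine Finset.sum_congr rfl fun i _ => ?_
    rw [iteratedDerivWithin_eq_iteratedDeriv (uniqueDiffOn_uIcc hne)
      (hh.of_le (by exact_mod_cast le_top)).contDiffAt Set.left_mem_uIcc]
    simp only [add_sub_cancel_left, smul_eq_mul]
    field_simp
  rw [hsum] at hx'
  rw [hx', abs_div, abs_mul, abs_pow, add_sub_cancel_left, Nat.abs_cast]
  have h1 : (1 : ℝ) ≤ (l + 1).factorial := by
    exact_mod_cast Nat.succ_le_of_lt (Nat.factorial_pos _)
  calc _ ≤ C * |t| ^ (l + 1) / 1 := by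
        gcongr
        exact hC x'
    _ = _ := div_one _

theorem integrable_mul_of_continuous {ψ k : ℝ → ℝ} {R : ℝ} (hψ : Integrable ψ)
    (hR : ∀ x, R < |x| → ψ x = 0) (hk : Continuous k) : Integrable fun x => k x * ψ x := by
  obtain ⟨C, hC⟩ := (isCompact_Icc (a := -R) (b := R)).exists_bound_of_continuousOn
    hk.continuousOn
  refine Integrable.mono' (hψ.abs.const_mul C) (hk.aestronglyMeasurable.mul
    hψ.aestronglyMeasurable) (Filter.Eventually.of_forall fun x => ?_)
  rcases lt_or_ge R |x| with hx | hx
  · simp [hR x hx]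
  · rw [norm_mul, Real.norm_eq_abs (ψ x)]
    exact mul_le_mul_of_nonneg_right (hC x (abs_le.1 hx)) (abs_nonneg _)

/-- A function with vanishing moments below `l` extracts the derivative of order `l`. -/
theorem abs_integral_sub_moment_le {ψ h : ℝ → ℝ} {R : ℝ} (hψ : Integrable ψ)
    (hR : ∀ x, R < |x| → ψ x = 0) (hh : ContDiff ℝ ∞ h) {l : ℕ} {C : ℝ}
    (hC : ∀ x, |iteratedDeriv (l + 1) h x| ≤ C) (hmom : ∀ i < l, ∫ y, y ^ i * ψ y = 0)
    (x₀ : ℝ) {δ : ℝ} (hδ : 0 ≤ δ) :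
    |(∫ y, h (x₀ + δ * y) * ψ y) -
      iteratedDeriv l h x₀ * δ ^ l / l.factorial * ∫ y, y ^ l * ψ y| ≤
      C * (δ * R) ^ (l + 1) * ∫ y, |ψ y| := by
  have hC0 : 0 ≤ C := (abs_nonneg _).trans (hC 0)
  set P : ℝ → ℝ := fun y =>
    ∑ i ∈ Finset.range (l + 1), iteratedDeriv i h x₀ * (δ * y) ^ i / i.factorial with hP
  have hmi : ∀ i : ℕ, Integrable fun y => y ^ i * ψ y := fun i =>
    integrable_mul_of_continuous hψ hR (by fun_prop)
  have hPi : ∫ y, P y * ψ y = iteratedDeriv l h x₀ * δ ^ l / l.factorial * ∫ y, y ^ l * ψ y := by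
    have e : ∀ y, P y * ψ y = ∑ i ∈ Finset.range (l + 1),
        iteratedDeriv i h x₀ * δ ^ i / i.factorial * (y ^ i * ψ y) := by
      intro y
      rw [hP, Finset.sum_mul]
      refine Finset.sum_congr rfl fun i _ => ?_
      rw [mul_pow]
      ring
    simp_rw [e]
    rw [integral_finsetSum _ fun i _ => (hmi i).const_mul _, Finset.sum_range_succ,
      Finset.sum_eq_zero, zero_add, integral_const_mul]
    intro i hi
    rw [integral_const_mul, hmom i (Finset.mem_range.1 hi), mul_zero]
  have hhi : Integrable fun y => h (x₀ + δ * y) * ψ y :=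
    integrable_mul_of_continuous hψ hR (hh.continuous.comp (by fun_prop))
  have hPint : Integrable fun y => P y * ψ y :=
    integrable_mul_of_continuous hψ hR (by fun_prop)
  rw [← hPi, ← integral_sub hhi hPint]
  refine abs_integral_le_integral_abs.trans ?_
  rw [← integral_const_mul]
  refine integral_mono_of_nonneg (Filter.Eventually.of_forall fun y => abs_nonneg _)
    (hψ.abs.const_mul _) (Filter.Eventually.of_forall fun y => ?_)
  simp only
  rw [← sub_mul, abs_mul]
  rcases lt_or_ge R |y| with hy | hy
  · simp [hR y hy]
  · refine mul_le_mul_of_nonneg_right ((abs_sub_taylor_le hh hC x₀ (δ * y)).trans ?_)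
      (abs_nonneg _)
    rw [abs_mul, abs_of_nonneg hδ]
    gcongr

/-! ### Mollification -/

/-- A sequence of bump functions shrinking to the origin. -/
def shrinkingBump (n : ℕ) : ContDiffBump (0 : ℝ) where
  rIn := 1 / (n + 1) / 2
  rOut := 1 / (n + 1)
  rIn_pos := by positivity
  rIn_lt_rOut := half_lt_self (by positivity)

theorem shrinkingBump_rOut_le (n : ℕ) : (shrinkingBump n).rOut ≤ 1 := by
  have : (0 : ℝ) ≤ n := n.cast_nonneg
  change (1 : ℝ) / (n + 1) ≤ 1
  rw [div_le_one (by positivity)]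
  linarith

/-- The mollifications of a function. -/
def mollify (ψ : ℝ → ℝ) (n : ℕ) : ℝ → ℝ :=
  convolution ((shrinkingBump n).normed volume) ψ (ContinuousLinearMap.lsmul ℝ ℝ) volume

section

variable {ψ : ℝ → ℝ}

theorem contDiff_mollify (hψ : LocallyIntegrable ψ) (n : ℕ) : ContDiff ℝ ∞ (mollify ψ n) :=
  (shrinkingBump n).hasCompactSupport_normed.contDiff_convolution_left _
    (shrinkingBump n).contDiff_normed hψ

theorem iteratedDeriv_mollify (hψ : LocallyIntegrable ψ) (n i : ℕ) :
    iteratedDeriv i (mollify ψ n) =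
      convolution (iteratedDeriv i ((shrinkingBump n).normed volume)) ψ
        (ContinuousLinearMap.lsmul ℝ ℝ) volume := by
  induction i with
  | zero => simp [mollify]
  | succ i ih =>
    rw [iteratedDeriv_succ, ih, iteratedDeriv_succ]
    funext x
    have hs : ContDiff ℝ ∞ ((shrinkingBump n).normed volume) := (shrinkingBump n).contDiff_normed
    exact (HasCompactSupport.hasDerivAt_convolution_left _
      (hasCompactSupport_iteratedDeriv (shrinkingBump n).hasCompactSupport_normed i)
      ((contDiff_iteratedDeriv_of_smooth hs i).of_le (by exact_mod_cast le_top)) hψ x).deriv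

theorem iteratedDeriv_mollify_eq_zero {R : ℝ} (hR : ∀ x, R < |x| → ψ x = 0)
    (n i : ℕ) {x : ℝ} (hx : R + 1 < |x|) : iteratedDeriv i (mollify ψ n) x = 0 := by
  have h0 : Set.EqOn (mollify ψ n) 0 {x | R + 1 < |x|} := by
    intro x hx
    rw [mollify, convolution_def]
    refine integral_eq_zero_of_ae (Filter.Eventually.of_forall fun t => ?_)
    rcases lt_or_ge |t| 1 with ht | ht
    · have : R < |x - t| := by
        have := abs_sub_abs_le_abs_sub x t
        simp only [Set.mem_ofPred_eq] at hx
        linarith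
      simp [hR _ this]
    · have : t ∉ Function.support ((shrinkingBump n).normed volume) := by
        rw [ContDiffBump.support_normed_eq, Metric.mem_ball, dist_zero_right, Real.norm_eq_abs]
        exact not_lt.2 ((shrinkingBump_rOut_le n).trans ht)
      simp [Function.notMem_support.1 this]
  have h1 := h0.iteratedDeriv_of_isOpen (isOpen_lt continuous_const continuous_abs) i hx
  rw [h1]
  simp

/-- Up to sign, the derivative at `x` is `ψ` tested against the derivative of the reflected bump `y
↦ ρ (x - y)`, whose `L¹` norm is one. The bound is therefore uniform in `n`. -/
theorem abs_iteratedDeriv_mollify_le (hψ : LocallyIntegrable ψ) {m : ℕ} {K : ℝ}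
    (hK : ∀ η : ℝ → ℝ, ContDiff ℝ ∞ η → HasCompactSupport η →
      |∫ x, ψ x * iteratedDeriv m η x| ≤ K * ∫ x, |η x|) (n : ℕ) (x : ℝ) :
    |iteratedDeriv m (mollify ψ n) x| ≤ K := by
  set ρ := (shrinkingBump n).normed (volume : Measure ℝ) with hρ
  have hs : ContDiff ℝ ∞ ρ := (shrinkingBump n).contDiff_normed
  set η : ℝ → ℝ := fun y => ρ (x - y) with hη
  have hηs : ContDiff ℝ ∞ η := hs.comp (by fun_prop)
  have hηc : HasCompactSupport η := by
    have : η = ρ ∘ (Homeomorph.subLeft x) := by funext y; simp [hη]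
    rw [this]
    exact (shrinkingBump n).hasCompactSupport_normed.comp_homeomorph _
  have h1 := hK η hηs hηc
  have h2 : ∫ y, |η y| = 1 := by
    have : ∀ y, |η y| = ρ (x - y) := fun y => abs_of_nonneg ((shrinkingBump n).nonneg_normed _)
    simp_rw [this]
    rw [integral_sub_left_eq_self ρ volume x, hρ, ContDiffBump.integral_normed]
  have h3 : iteratedDeriv m (mollify ψ n) x = (-1) ^ m * ∫ y, ψ y * iteratedDeriv m η y := by
    rw [iteratedDeriv_mollify hψ, convolution_eq_swap, ← integral_const_mul]
    refine integral_congr_ae (Filter.Eventually.of_forall fun y => ?_)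
    simp only [hη, iteratedDeriv_comp_const_sub, smul_eq_mul, ContinuousLinearMap.lsmul_apply]
    have : ((-1 : ℝ) ^ m) * (-1) ^ m = 1 := by rw [← mul_pow]; simp
    linear_combination (-ψ y * iteratedDeriv m ρ (x - y)) * this
  rw [h3, abs_mul, abs_pow, abs_neg, abs_one, one_pow, one_mul]
  simpa [h2] using h1

theorem ae_tendsto_mollify (hψ : LocallyIntegrable ψ) :
    ∀ᵐ x, Filter.Tendsto (fun n => mollify ψ n x) Filter.atTop (nhds (ψ x)) := by
  -- The bumps shrink with the fixed ratio 2 between outer and inner radius, as Lebesgue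
  -- differentiation requires.
  refine ContDiffBump.ae_convolution_tendsto_right_of_locallyIntegrable (K := 2)
    tendsto_one_div_add_atTop_nhds_zero_nat (Filter.Eventually.of_forall fun n => ?_) hψ
  change (1 : ℝ) / (n + 1) ≤ 2 * (1 / (n + 1) / 2)
  linarith

end

/-! ### Integrating bounds and limits -/

theorem eq_intervalIntegral_of_hasDerivAt {u v : ℝ → ℝ} {R : ℝ}
    (hd : ∀ x, HasDerivAt u (v x) x) (hv : Continuous v) (h0 : u (-R) = 0) (x : ℝ) :
    u x = ∫ y in (-R)..x, v y := by
  rw [intervalIntegral.integral_eq_sub_of_hasDerivAt (fun y _ => hd y)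
    (hv.intervalIntegrable _ _), h0, sub_zero]

theorem abs_le_of_hasDerivAt_of_support {u v : ℝ → ℝ} {R C : ℝ} (hR : 0 ≤ R) (hC0 : 0 ≤ C)
    (hd : ∀ x, HasDerivAt u (v x) x) (hv : Continuous v) (h0 : ∀ x, R ≤ |x| → u x = 0)
    (hC : ∀ x, |v x| ≤ C) (x : ℝ) : |u x| ≤ C * (2 * R) := by
  rcases le_or_gt R |x| with hx | hx
  · rw [h0 x hx, abs_zero]; positivity
  · rw [eq_intervalIntegral_of_hasDerivAt hd hv (h0 (-R) (by simp [abs_of_nonneg hR])) x,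
      ← Real.norm_eq_abs]
    refine (intervalIntegral.norm_integral_le_of_norm_le_const fun y _ => hC y).trans ?_
    gcongr
    have := abs_lt.1 hx
    rw [abs_le]
    constructor <;> linarith

theorem tendsto_zero_of_hasDerivAt_of_support {u v : ℕ → ℝ → ℝ} {R C : ℝ} (hR : 0 ≤ R)
    (hd : ∀ n x, HasDerivAt (u n) (v n x) x) (hv : ∀ n, Continuous (v n))
    (h0 : ∀ n x, R ≤ |x| → u n x = 0) (hC : ∀ n x, |v n x| ≤ C)
    (hlim : ∀ x, Filter.Tendsto (fun n => v n x) Filter.atTop (nhds 0)) (x : ℝ) :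
    Filter.Tendsto (fun n => u n x) Filter.atTop (nhds 0) := by
  have e : ∀ n, u n x = ∫ y in (-R)..x, v n y := fun n =>
    eq_intervalIntegral_of_hasDerivAt (hd n) (hv n) (h0 n (-R) (by simp [abs_of_nonneg hR])) x
  simp_rw [e]
  have := intervalIntegral.tendsto_integral_filter_of_dominated_convergence (μ := volume)
    (a := -R) (b := x) (F := v) (f := fun _ => (0 : ℝ)) (l := Filter.atTop) (fun _ => C)
    (Filter.Eventually.of_forall fun n => (hv n).aestronglyMeasurable)
    (Filter.Eventually.of_forall fun n => Filter.Eventually.of_forall fun y _ => hC n y)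
    intervalIntegrable_const (Filter.Eventually.of_forall fun y _ => hlim y)
  simpa using this

/-! ### Vanishing moments -/

section

variable {ψ : ℝ → ℝ} {R K : ℝ} {m : ℕ}

/-- Descending from order `m`: all derivatives vanish outside one fixed interval, so a bound on one
integrates to a bound on the previous one, still uniform in `n`. -/
theorem exists_bound_iteratedDeriv_mollify (hψ : LocallyIntegrable ψ) (hR0 : 0 ≤ R)
    (hR : ∀ x, R < |x| → ψ x = 0)
    (hK : ∀ η : ℝ → ℝ, ContDiff ℝ ∞ η → HasCompactSupport η →
      |∫ x, ψ x * iteratedDeriv m η x| ≤ K * ∫ x, |η x|) {i : ℕ} (hi : i ≤ m) :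
    ∃ C, 0 ≤ C ∧ ∀ n x, |iteratedDeriv i (mollify ψ n) x| ≤ C := by
  induction hi using Nat.decreasingInduction with
  | self => exact ⟨K, (abs_nonneg _).trans (abs_iteratedDeriv_mollify_le hψ hK 0 0),
      abs_iteratedDeriv_mollify_le hψ hK⟩
  | of_succ i hi ih =>
    obtain ⟨C, hC0, hC⟩ := ih
    -- The radius `R + 2` leaves room because vanishing is known only strictly beyond `R + 1`.
    exact ⟨C * (2 * (R + 2)), by positivity, fun n =>
      abs_le_of_hasDerivAt_of_support (by positivity) hC0
        (hasDerivAt_iteratedDeriv (contDiff_mollify hψ n) i)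
        (contDiff_iteratedDeriv_of_smooth (contDiff_mollify hψ n) _).continuous
        (fun x hx => iteratedDeriv_mollify_eq_zero hR n i (by linarith)) (hC n)⟩

theorem exists_ae_bound_of_weak_bound (hψ : LocallyIntegrable ψ) (hR0 : 0 ≤ R)
    (hR : ∀ x, R < |x| → ψ x = 0)
    (hK : ∀ η : ℝ → ℝ, ContDiff ℝ ∞ η → HasCompactSupport η →
      |∫ x, ψ x * iteratedDeriv m η x| ≤ K * ∫ x, |η x|) :
    ∃ B, ∀ᵐ x, |ψ x| ≤ B := by
  obtain ⟨C, _, hC⟩ := exists_bound_iteratedDeriv_mollify hψ hR0 hR hK m.zero_le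
  refine ⟨C, ?_⟩
  filter_upwards [ae_tendsto_mollify hψ] with x hx
  exact le_of_tendsto hx.abs (Filter.Eventually.of_forall fun n => by simpa using hC n x)

/-- After rescaling, this is the pairing of the mollified `ψ` with a wavelet of level `j`; dominated
convergence leads to the pairing with `ψ` itself, which is zero. The centred form is the one to
which a Taylor expansion applies. -/
theorem tendsto_integral_mollify (hψ : Integrable ψ) (hR0 : 0 ≤ R)
    (hR : ∀ x, R < |x| → ψ x = 0)
    (hK : ∀ η : ℝ → ℝ, ContDiff ℝ ∞ η → HasCompactSupport η →
      |∫ x, ψ x * iteratedDeriv m η x| ≤ K * ∫ x, |η x|)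
    {j k : ℤ} (horth : ∫ x, ψ x * ψ ((2 : ℝ) ^ j * x - k) = 0) :
    Filter.Tendsto
      (fun n => ∫ y, mollify ψ n (((2 : ℝ) ^ j)⁻¹ * k + ((2 : ℝ) ^ j)⁻¹ * y) * ψ y)
      Filter.atTop (nhds 0) := by
  have hl := hψ.locallyIntegrable
  have h2 : (2 : ℝ) ^ j ≠ 0 := zpow_ne_zero _ two_ne_zero
  obtain ⟨C, _, hC⟩ := exists_bound_iteratedDeriv_mollify hl hR0 hR hK m.zero_le
  simp only [iteratedDeriv_zero] at hC
  have e : ∀ n, ∫ y, mollify ψ n (((2 : ℝ) ^ j)⁻¹ * k + ((2 : ℝ) ^ j)⁻¹ * y) * ψ y =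
      (2 : ℝ) ^ j * ∫ x, mollify ψ n x * ψ ((2 : ℝ) ^ j * x - k) := by
    intro n
    have := integral_comp_dyadic
      (fun y => mollify ψ n (((2 : ℝ) ^ j)⁻¹ * k + ((2 : ℝ) ^ j)⁻¹ * y) * ψ y) j k
    rw [eq_inv_mul_iff_mul_eq₀ h2] at this
    rw [← this]
    congr 2
    funext x
    congr 2
    field_simp
    ring
  simp_rw [e]
  rw [← mul_zero ((2 : ℝ) ^ j), ← horth]
  refine Filter.Tendsto.const_mul _ ?_
  have hψj : Integrable fun x => ψ ((2 : ℝ) ^ j * x - k) :=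
    (hψ.comp_sub_right (k : ℝ)).comp_mul_left' h2
  refine tendsto_integral_of_dominated_convergence (fun x => C * |ψ ((2 : ℝ) ^ j * x - k)|)
    (fun n => ((contDiff_mollify hl n).continuous.aestronglyMeasurable.mul
      hψj.aestronglyMeasurable)) (hψj.abs.const_mul C) (fun n => ?_) ?_
  · refine Filter.Eventually.of_forall fun x => ?_
    rw [norm_mul, Real.norm_eq_abs, Real.norm_eq_abs]
    exact mul_le_mul_of_nonneg_right (hC n x) (abs_nonneg _)
  · filter_upwards [ae_tendsto_mollify hl] with x hx
    exact hx.mul_const _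

/-- Let `l` be the first order with nonzero moment `M`. Pairing the mollified `ψ` with a wavelet at
scale `δ` near `x` gives `δ^l M / l!` times its derivative of order `l`, up to `O(δ^{l+1})`, and
this pairing tends to zero. Hence these derivatives tend to zero at every point; integrating `l`
times, so do the mollifications, contradicting `ψ ≠ 0`. The Taylor remainder uses the derivative of
order `l + 1 ≤ N + 1`. -/
theorem moment_eq_zero {N : ℕ} (hψ : Integrable ψ) (hR0 : 0 ≤ R)
    (hR : ∀ x, R < |x| → ψ x = 0)
    (hK : ∀ η : ℝ → ℝ, ContDiff ℝ ∞ η → HasCompactSupport η →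
      |∫ x, ψ x * iteratedDeriv (N + 1) η x| ≤ K * ∫ x, |η x|)
    (horth : ∀ j k : ℤ, 1 ≤ j → ∫ x, ψ x * ψ ((2 : ℝ) ^ j * x - k) = 0)
    (hne : ¬ ψ =ᵐ[volume] 0) {l : ℕ} (hl : l ≤ N) : ∫ y, y ^ l * ψ y = 0 := by
  induction l using Nat.strong_induction_on with
  | _ l ih =>
  have hloc := hψ.locallyIntegrable
  by_contra hM
  set M := ∫ y, y ^ l * ψ y with hMdef
  have hM0 : 0 < |M| := abs_pos.2 hM
  obtain ⟨C, hC0, hC⟩ := exists_bound_iteratedDeriv_mollify hloc hR0 hR hK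
    (show l + 1 ≤ N + 1 by omega)
  have hlip : ∀ n x y, |iteratedDeriv l (mollify ψ n) x - iteratedDeriv l (mollify ψ n) y| ≤
      C * |x - y| := by
    intro n x y
    have := Convex.norm_image_sub_le_of_norm_hasDerivWithin_le (s := Set.univ) (C := C)
      (f := iteratedDeriv l (mollify ψ n)) (f' := iteratedDeriv (l + 1) (mollify ψ n))
      (fun z _ => (hasDerivAt_iteratedDeriv (contDiff_mollify hloc n) l z).hasDerivWithinAt)
      (fun z _ => hC n z) convex_univ (Set.mem_univ y) (Set.mem_univ x)
    simpa using this
  set A := ∫ y, |ψ y| with hA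
  have hA0 : 0 ≤ A := integral_nonneg fun y => abs_nonneg _
  -- The Taylor error after division by `|M| δ^l / l!`, plus the Lipschitz cost of moving from the
  -- grid point to `x`, both per unit of `δ`.
  set E := l.factorial / |M| * (C * R ^ (l + 1) * A) + C with hE
  have hE0 : 0 ≤ E := by positivity
  have hlim : ∀ x, Filter.Tendsto (fun n => iteratedDeriv l (mollify ψ n) x)
      Filter.atTop (nhds 0) := by
    intro x
    rw [Metric.tendsto_atTop]
    intro ε hε
    obtain ⟨j, hj⟩ := exists_pow_lt_of_lt_one (show 0 < ε / 2 / (E + 1) by positivity)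
      (show (2⁻¹ : ℝ) < 1 by norm_num)
    -- The level `j + 1` is positive, where orthogonality to `ψ` holds for every shift.
    set δ : ℝ := ((2 : ℝ) ^ ((j + 1 : ℕ) : ℤ))⁻¹ with hδ
    have hδ0 : 0 < δ := by positivity
    have hδE : E * δ < ε / 2 := by
      have h1 : δ ≤ (2⁻¹ : ℝ) ^ j := by
        rw [hδ, zpow_natCast, inv_pow]
        gcongr
        · norm_num
        · omega
      have h2 : δ < ε / 2 / (E + 1) := h1.trans_lt hj
      rw [lt_div_iff₀ (by positivity)] at h2
      nlinarith
    set k : ℤ := ⌊δ⁻¹ * x⌋ with hk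
    have hxk : |x - δ * k| ≤ δ := by
      have h1 : x = δ * (δ⁻¹ * x) := by field_simp
      have h2 : x - δ * k = δ * Int.fract (δ⁻¹ * x) := by
        rw [Int.fract]
        linear_combination h1
      rw [h2, abs_mul, abs_of_pos hδ0, abs_of_nonneg (Int.fract_nonneg _)]
      exact mul_le_of_le_one_right hδ0.le (Int.fract_lt_one _).le
    have hlim0 := tendsto_integral_mollify hψ hR0 hR hK
      (horth ((j + 1 : ℕ) : ℤ) k (by push_cast; omega))
    rw [← hδ] at hlim0
    -- Chosen to contribute exactly `ε / 2` after division by `|M| δ^l / l!`.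
    set τ := ε / 2 * (|M| / l.factorial * δ ^ l) with hτ
    have hτ0 : 0 < τ := by positivity
    obtain ⟨n₀, hn₀⟩ := (Metric.tendsto_atTop.1 hlim0) τ hτ0
    refine ⟨n₀, fun n hn => ?_⟩
    have ha := hn₀ n hn
    rw [Real.dist_eq, sub_zero] at ha ⊢
    have hT := abs_integral_sub_moment_le hψ hR (contDiff_mollify hloc n) (hC n)
      (fun i hi => ih i hi (by omega)) (δ * k) hδ0.le
    set a := ∫ y, mollify ψ n (δ * k + δ * y) * ψ y
    set D := iteratedDeriv l (mollify ψ n) (δ * k)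
    have h1 : |D * δ ^ l / l.factorial * M| ≤ C * (δ * R) ^ (l + 1) * A + |a| := by
      have := abs_sub_abs_le_abs_sub (D * δ ^ l / l.factorial * M) a
      rw [abs_sub_comm] at hT
      linarith
    have h2 : |D| * (|M| / l.factorial * δ ^ l) < C * (δ * R) ^ (l + 1) * A + τ := by
      refine lt_of_eq_of_lt ?_ (h1.trans_lt (by linarith))
      rw [abs_mul, abs_div, abs_mul, abs_pow, abs_of_pos hδ0, Nat.abs_cast]
      ring
    have hw : 0 < |M| / l.factorial * δ ^ l := by positivity
    have h3 : |D| < l.factorial / |M| * (C * R ^ (l + 1) * A) * δ + ε / 2 := by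
      rw [← lt_div_iff₀ hw] at h2
      refine h2.trans_eq ?_
      rw [hτ, add_div, mul_div_assoc (ε / 2), div_self hw.ne', mul_one, mul_pow, pow_succ δ]
      field_simp
    have h4 := hlip n x (δ * k)
    have h5 := abs_sub_abs_le_abs_sub (iteratedDeriv l (mollify ψ n) x) D
    have h6 : C * |x - δ * k| ≤ C * δ := by gcongr
    have h7 : E * δ = l.factorial / |M| * (C * R ^ (l + 1) * A) * δ + C * δ := by
      rw [hE]; ring
    linarith
  have hdesc : ∀ i ≤ l, ∀ x, Filter.Tendsto (fun n => iteratedDeriv i (mollify ψ n) x)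
      Filter.atTop (nhds 0) := by
    intro i hi
    induction hi using Nat.decreasingInduction with
    | self => exact hlim
    | of_succ i hi ihd =>
      obtain ⟨C', _, hC'⟩ := exists_bound_iteratedDeriv_mollify hloc hR0 hR hK
        (show i + 1 ≤ N + 1 by omega)
      exact tendsto_zero_of_hasDerivAt_of_support (R := R + 2) (by positivity)
        (fun n => hasDerivAt_iteratedDeriv (contDiff_mollify hloc n) i)
        (fun n => (contDiff_iteratedDeriv_of_smooth (contDiff_mollify hloc n) _).continuous)
        (fun n x hx => iteratedDeriv_mollify_eq_zero hR n i (by linarith)) hC' ihd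
  refine hne ?_
  filter_upwards [ae_tendsto_mollify hloc] with x hx
  exact tendsto_nhds_unique hx (by simpa using hdesc 0 l.zero_le x)

end

/-! ### Sequence norms -/

/-- Each term is at most the sum `S`, so the `p`-th powers sum to at most `S^{p-1} · S`. -/
theorem eLpNorm_count_le_tsum {ι ε : Type*} [MeasurableSpace ι] [MeasurableSingletonClass ι]
    [TopologicalSpace ε] [ESeminormedAddMonoid ε] (f : ι → ε) {p : ℝ≥0∞} (hp : 1 ≤ p) :
    eLpNorm f p Measure.count ≤ ∑' i, ‖f i‖ₑ := by
  have hp0 : p ≠ 0 := (zero_lt_one.trans_le hp).ne'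
  rcases eq_or_ne p ⊤ with rfl | hpt
  · rw [eLpNorm_exponent_top, eLpNormEssSup_count]
    exact iSup_le fun i => ENNReal.le_tsum i
  have hp1 : 1 ≤ p.toReal := by
    rwa [← ENNReal.toReal_one, ENNReal.toReal_le_toReal ENNReal.one_ne_top hpt]
  rw [eLpNorm_eq_lintegral_rpow_enorm_toReal hp0 hpt, lintegral_count]
  set S := ∑' i, ‖f i‖ₑ with hS
  have hsplit : ∀ x : ℝ≥0∞, x ^ p.toReal = x * x ^ (p.toReal - 1) := fun x => by
    conv_rhs => rw [← ENNReal.rpow_one x, ← ENNReal.rpow_mul, one_mul]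
    rw [← ENNReal.rpow_add_of_nonneg _ _ zero_le_one (by linarith)]
    congr 1; ring
  calc (∑' i, ‖f i‖ₑ ^ p.toReal) ^ (1 / p.toReal)
      ≤ (∑' i, ‖f i‖ₑ * S ^ (p.toReal - 1)) ^ (1 / p.toReal) := by
        gcongr with i
        rw [hsplit]
        gcongr
        exact ENNReal.le_tsum i
    _ = (S ^ p.toReal) ^ (1 / p.toReal) := by rw [ENNReal.tsum_mul_right, ← hS, hsplit]
    _ = S := by rw [← ENNReal.rpow_mul, mul_one_div_cancel (by linarith), ENNReal.rpow_one]

theorem eLpNorm_count_le_of_support (f : ℤ → ℝ) (S : Finset ℤ) {M : ℝ}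
    (h0 : ∀ k, k ∉ S → f k = 0) (hM : ∀ k, |f k| ≤ M) (p : ℝ≥0∞) :
    eLpNorm f p Measure.count ≤ ENNReal.ofReal M * (S.card : ℝ≥0∞) ^ p.toReal⁻¹ := by
  have hM0 : 0 ≤ M := (abs_nonneg _).trans (hM 0)
  have h1 : eLpNorm f p Measure.count ≤
      eLpNorm ((S : Set ℤ).indicator fun _ => M) p Measure.count := by
    refine eLpNorm_mono_enorm fun k => ?_
    by_cases hk : k ∈ S
    · rw [Set.indicator_of_mem (by simpa using hk), Real.enorm_eq_ofReal_abs,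
        Real.enorm_eq_ofReal_abs, abs_of_nonneg hM0]
      exact ENNReal.ofReal_le_ofReal (hM k)
    · rw [h0 k hk]; simp
  refine h1.trans ((eLpNorm_indicator_const_le _ _).trans_eq ?_)
  rw [Real.enorm_eq_ofReal_abs, abs_of_nonneg hM0, Measure.count_apply_finset, one_div]

theorem card_Icc_ceil_floor_le {a b : ℝ} (hab : a ≤ b) :
    ((Finset.Icc ⌈a⌉ ⌊b⌋).card : ℝ) ≤ b - a + 1 := by
  rw [Int.card_Icc]
  have h1 := Int.floor_le b
  have h2 := Int.le_ceil a
  rcases le_total 0 (⌊b⌋ + 1 - ⌈a⌉) with h | h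
  · have : (((⌊b⌋ + 1 - ⌈a⌉).toNat : ℤ) : ℝ) = ((⌊b⌋ + 1 - ⌈a⌉ : ℤ) : ℝ) := by
      rw [Int.toNat_of_nonneg h]
    rw [Int.cast_natCast] at this
    rw [this]
    push_cast
    linarith
  · rw [Int.toNat_of_nonpos h]
    simp only [Nat.cast_zero]
    linarith

/-! ### The Besov norm as a seminorm -/

theorem integrable_mul_dyadic {f g : ℝ → ℝ} (hf : Integrable f)
    (hg : AEStronglyMeasurable g volume) {B : ℝ} (hB : ∀ᵐ x, |g x| ≤ B) (j k : ℤ) :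
    Integrable fun x => f x * dyadic g j k x := by
  refine hf.mul_bdd (c := (2 : ℝ) ^ ((j : ℝ) / 2) * B)
    ((hg.comp_quasiMeasurePreserving (quasiMeasurePreserving_dyadic j k)).const_mul _) ?_
  filter_upwards [(quasiMeasurePreserving_dyadic j k).ae hB] with x hx
  rw [dyadic, norm_mul, Real.norm_eq_abs, Real.norm_eq_abs, abs_of_nonneg (by positivity)]
  gcongr

theorem waveletCoeff_congr_ae {g g' : ℝ → ℝ} (h : g =ᵐ[volume] g') (f : ℝ → ℝ) (j k : ℤ) :
    waveletCoeff g f j k = waveletCoeff g' f j k := by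
  refine integral_congr_ae ?_
  filter_upwards [dyadic_congr_ae h j k] with x hx
  rw [hx]

theorem waveletCoeff_congr_ae_right {f f' : ℝ → ℝ} (h : f =ᵐ[volume] f') (g : ℝ → ℝ) (j k : ℤ) :
    waveletCoeff g f j k = waveletCoeff g f' j k := by
  refine integral_congr_ae ?_
  filter_upwards [h] with x hx
  rw [hx]

theorem besovNorm_congr_ae_right {f f' : ℝ → ℝ} (h : f =ᵐ[volume] f') (φ ψ : ℝ → ℝ) (s : ℝ)
    (p q : ℝ≥0∞) : besovNorm φ ψ s p q f = besovNorm φ ψ s p q f' := by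
  simp only [besovNorm, waveletCoeff_congr_ae_right h]

theorem besovNorm_congr_ae_wavelet {ψ ψ' : ℝ → ℝ} (h : ψ =ᵐ[volume] ψ') (φ : ℝ → ℝ) (s : ℝ)
    (p q : ℝ≥0∞) : besovNorm φ ψ s p q = besovNorm φ ψ' s p q := by
  funext f
  simp only [besovNorm, waveletCoeff_congr_ae h]

theorem waveletCoeff_add {f f' g : ℝ → ℝ} (hf : Integrable f) (hf' : Integrable f')
    (hg : AEStronglyMeasurable g volume) {B : ℝ} (hB : ∀ᵐ x, |g x| ≤ B) (j k : ℤ) :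
    waveletCoeff g (fun x => f x + f' x) j k = waveletCoeff g f j k + waveletCoeff g f' j k := by
  simp only [waveletCoeff, add_mul]
  exact integral_add (integrable_mul_dyadic hf hg hB j k) (integrable_mul_dyadic hf' hg hB j k)

theorem waveletCoeff_const_mul (c : ℝ) (f g : ℝ → ℝ) (j k : ℤ) :
    waveletCoeff g (fun x => c * f x) j k = c * waveletCoeff g f j k := by
  simp only [waveletCoeff, mul_assoc, integral_const_mul]

section

variable {φ ψ : ℝ → ℝ} {s : ℝ} {p q : ℝ≥0∞}

/-- Minkowski in `ℓ^p` at each level and then in `ℓ^q`. Bounded wavelets make every coefficient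
integral converge, so that coefficients are additive. -/
theorem besovNorm_add_le (hp : 1 ≤ p) (hq : 1 ≤ q)
    (hφ : AEStronglyMeasurable φ volume) (hψ : AEStronglyMeasurable ψ volume) {B B' : ℝ}
    (hB : ∀ᵐ x, |φ x| ≤ B) (hB' : ∀ᵐ x, |ψ x| ≤ B') {f f' : ℝ → ℝ} (hf : Integrable f)
    (hf' : Integrable f') :
    besovNorm φ ψ s p q (fun x => f x + f' x) ≤
      besovNorm φ ψ s p q f + besovNorm φ ψ s p q f' := by
  have hlev : ∀ {g : ℝ → ℝ}, AEStronglyMeasurable g volume → ∀ {B : ℝ}, (∀ᵐ x, |g x| ≤ B) →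
      ∀ j : ℤ, eLpNorm (fun k : ℤ => waveletCoeff g (fun x => f x + f' x) j k) p Measure.count ≤
        eLpNorm (fun k : ℤ => waveletCoeff g f j k) p Measure.count +
          eLpNorm (fun k : ℤ => waveletCoeff g f' j k) p Measure.count := by
    intro g hg B hB j
    simp only [waveletCoeff_add hf hf' hg hB]
    exact eLpNorm_add_le (measurable_from_top.aestronglyMeasurable)
      (measurable_from_top.aestronglyMeasurable) hp
  rw [besovNorm, besovNorm, besovNorm, add_add_add_comm]
  refine add_le_add (hlev hφ hB 0) ?_
  refine le_trans ?_ (eLpNorm_add_le (measurable_from_top.aestronglyMeasurable)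
    (measurable_from_top.aestronglyMeasurable) hq)
  refine eLpNorm_mono_enorm fun j => ?_
  simp only [enorm_eq_self, Pi.add_apply]
  rw [← mul_add]
  gcongr
  exact hlev hψ hB' j

theorem besovNorm_const_mul_le {c : ℝ} (hc : 0 ≤ c) (f : ℝ → ℝ) :
    besovNorm φ ψ s p q (fun x => c * f x) ≤ ENNReal.ofReal c * besovNorm φ ψ s p q f := by
  have hlev : ∀ (g : ℝ → ℝ) (j : ℤ),
      eLpNorm (fun k : ℤ => waveletCoeff g (fun x => c * f x) j k) p Measure.count ≤
        ENNReal.ofReal c * eLpNorm (fun k : ℤ => waveletCoeff g f j k) p Measure.count := by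
    intro g j
    refine eLpNorm_le_mul_eLpNorm_of_ae_le_mul' (c := c.toNNReal)
      (Filter.Eventually.of_forall fun k => ?_) p
    rw [waveletCoeff_const_mul, enorm_mul, Real.enorm_eq_ofReal_abs c, abs_of_nonneg hc]
    rfl
  rw [besovNorm, besovNorm, mul_add]
  refine add_le_add (hlev φ 0) ?_
  refine eLpNorm_le_mul_eLpNorm_of_ae_le_mul' (c := c.toNNReal)
    (Filter.Eventually.of_forall fun j => ?_) q
  simp only [enorm_eq_self]
  rw [mul_left_comm]
  gcongr
  exact hlev ψ j

/-! ### Smooth functions have finite Besov norm -/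

theorem waveletCoeff_eq_integral (f g : ℝ → ℝ) (j k : ℤ) :
    waveletCoeff g f j k = (2 : ℝ) ^ (-((j : ℝ) / 2)) *
      ∫ y, f (((2 : ℝ) ^ j)⁻¹ * k + ((2 : ℝ) ^ j)⁻¹ * y) * g y := by
  have h2 : (2 : ℝ) ^ j ≠ 0 := zpow_ne_zero _ two_ne_zero
  have h1 := integral_comp_dyadic
    (fun y => f (((2 : ℝ) ^ j)⁻¹ * k + ((2 : ℝ) ^ j)⁻¹ * y) * g y) j k
  rw [eq_inv_mul_iff_mul_eq₀ h2] at h1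
  have h3 : (2 : ℝ) ^ (-((j : ℝ) / 2)) * (2 : ℝ) ^ j = (2 : ℝ) ^ ((j : ℝ) / 2) := by
    rw [← two_rpow_half_mul_self j, ← mul_assoc, ← Real.rpow_add two_pos, neg_add_cancel,
      Real.rpow_zero, one_mul]
  rw [← h1, ← mul_assoc, h3, ← integral_const_mul]
  refine integral_congr_ae (Filter.Eventually.of_forall fun x => ?_)
  simp only [dyadic]
  have : ((2 : ℝ) ^ j)⁻¹ * k + ((2 : ℝ) ^ j)⁻¹ * ((2 : ℝ) ^ j * x - k) = x := by
    field_simp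
    ring
  rw [this]
  ring

theorem tsum_enorm_translate_le {g : ℝ → ℝ} {T M : ℝ} (hT : 0 ≤ T)
    (hg0 : ∀ x, T < |x| → g x = 0) (hgM : ∀ x, |g x| ≤ M) (y : ℝ) :
    ∑' k : ℤ, ‖g (y + k)‖ₑ ≤ ENNReal.ofReal ((2 * T + 1) * M) := by
  have hM0 : 0 ≤ M := (abs_nonneg _).trans (hgM 0)
  set S := Finset.Icc ⌈-T - y⌉ ⌊T - y⌋ with hS
  have h0 : ∀ k ∉ S, ‖g (y + k)‖ₑ = 0 := by
    intro k hk
    rw [hg0, enorm_zero]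
    by_contra! hle
    rw [abs_le] at hle
    refine hk (Finset.mem_Icc.2 ⟨Int.ceil_le.2 ?_, Int.le_floor.2 ?_⟩) <;> linarith
  have hcard := card_Icc_ceil_floor_le (show -T - y ≤ T - y by linarith)
  rw [tsum_eq_sum h0]
  calc ∑ k ∈ S, ‖g (y + k)‖ₑ ≤ ∑ _k ∈ S, ENNReal.ofReal M := by
        gcongr with k
        rw [Real.enorm_eq_ofReal_abs]
        exact ENNReal.ofReal_le_ofReal (hgM _)
    _ = ENNReal.ofReal (S.card * M) := by
        rw [Finset.sum_const, nsmul_eq_mul, ENNReal.ofReal_mul (by positivity),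
          ENNReal.ofReal_natCast]
    _ ≤ _ := by
        refine ENNReal.ofReal_le_ofReal ?_
        gcongr
        linarith

/-- As `φ` need not have compact support, the coefficients are summed first: the translates of `|g|`
have a bounded sum, and `φ` is integrable. -/
theorem eLpNorm_waveletCoeff_zero_lt_top (hp : 1 ≤ p) (hφ : Integrable φ) {g : ℝ → ℝ}
    (hg : Continuous g) {T M : ℝ} (hT : 0 ≤ T) (hg0 : ∀ x, T < |x| → g x = 0)
    (hgM : ∀ x, |g x| ≤ M) :
    eLpNorm (fun k : ℤ => waveletCoeff φ g 0 k) p Measure.count < ⊤ := by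
  refine (eLpNorm_count_le_tsum _ hp).trans_lt ?_
  have hterm : ∀ k : ℤ, ‖waveletCoeff φ g 0 k‖ₑ ≤ ∫⁻ y, ‖g (y + k)‖ₑ * ‖φ y‖ₑ := by
    intro k
    rw [waveletCoeff_eq_integral]
    simp only [Int.cast_zero, zero_div, neg_zero, Real.rpow_zero, one_mul, zpow_zero, inv_one]
    refine (enorm_integral_le_lintegral_enorm _).trans_eq ?_
    simp_rw [enorm_mul, add_comm (k : ℝ)]
  calc ∑' k : ℤ, ‖waveletCoeff φ g 0 k‖ₑ ≤ ∑' k : ℤ, ∫⁻ y, ‖g (y + k)‖ₑ * ‖φ y‖ₑ :=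
        ENNReal.tsum_le_tsum hterm
    _ = ∫⁻ y, (∑' k : ℤ, ‖g (y + k)‖ₑ) * ‖φ y‖ₑ := by
        rw [← lintegral_tsum fun k => ?_]
        · simp_rw [ENNReal.tsum_mul_right]
        · exact (hg.comp (by fun_prop)).measurable.enorm.aemeasurable.mul
            hφ.aestronglyMeasurable.enorm
    _ ≤ ∫⁻ y, ENNReal.ofReal ((2 * T + 1) * M) * ‖φ y‖ₑ := by
        gcongr with y
        exact tsum_enorm_translate_le hT hg0 hgM y
    _ < ⊤ := by
        rw [lintegral_const_mul' _ _ ENNReal.ofReal_ne_top]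
        exact ENNReal.mul_lt_top ENNReal.ofReal_lt_top hφ.hasFiniteIntegral

/-- Vanishing moments up to `N` make the coefficients at level `j` of order `2^{-j(N+3/2)}`, and
only about `2^j` of them are nonzero. The weighted level norms are then of order `2^{j(s-N-1)}`, a
geometric series because `s < N + 1`. -/
theorem besovNorm_lt_top_of_contDiff (hp : 1 ≤ p) (hq : 1 ≤ q) {N : ℕ} (hsN : s < N + 1)
    (hφ : Integrable φ) (hψ : Integrable ψ) {R : ℝ} (hR0 : 0 ≤ R)
    (hR : ∀ x, R < |x| → ψ x = 0) (hmom : ∀ l ≤ N, ∫ y, y ^ l * ψ y = 0)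
    {g : ℝ → ℝ} (hg : ContDiff ℝ ∞ g) (hgc : HasCompactSupport g) :
    besovNorm φ ψ s p q g < ⊤ := by
  obtain ⟨M, hM⟩ := hgc.exists_bound_of_continuous hg.continuous
  obtain ⟨C, hC⟩ := (hasCompactSupport_iteratedDeriv hgc (N + 1)).exists_bound_of_continuous
    (contDiff_iteratedDeriv_of_smooth hg (N + 1)).continuous
  have hC0 : 0 ≤ C := (norm_nonneg _).trans (hC 0)
  obtain ⟨T, hT0, hT⟩ := hgc.isCompact.isBounded.subset_closedBall_lt 0 0
  have hg0 : ∀ x, T < |x| → g x = 0 := by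
    intro x hx
    by_contra hne
    have := hT (subset_tsupport _ hne)
    rw [mem_closedBall_zero_iff, Real.norm_eq_abs] at this
    linarith
  set A := ∫ y, |ψ y| with hA
  have hA0 : 0 ≤ A := integral_nonneg fun y => abs_nonneg _
  -- At scale `b = 2^j ≥ 1` at most `2(bT + R) + 1 ≤ b D` wavelets meet the support of `g`.
  set D := 2 * T + 2 * R + 1 with hD
  have hD1 : 1 ≤ D := by linarith
  set t := p.toReal⁻¹ with ht
  have ht0 : 0 ≤ t := by positivity
  have ht1 : t ≤ 1 := by
    rcases eq_or_ne p ⊤ with rfl | hpt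
    · simp [ht]
    · refine inv_le_one_of_one_le₀ ?_
      rwa [← ENNReal.toReal_one, ENNReal.toReal_le_toReal ENNReal.one_ne_top hpt]
  set E := C * R ^ (N + 1) * A with hE
  have hE0 : 0 ≤ E := by positivity
  rw [besovNorm]
  refine ENNReal.add_lt_top.2
    ⟨eLpNorm_waveletCoeff_zero_lt_top hp hφ hg.continuous hT0.le hg0 hM, ?_⟩
  have hlevel : ∀ j : ℕ, ENNReal.ofReal ((2 : ℝ) ^ ((j : ℝ) * (s + 1 / 2 - t))) *
      eLpNorm (fun k : ℤ => waveletCoeff ψ g j k) p Measure.count ≤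
        ENNReal.ofReal (E * D * ((2 : ℝ) ^ (s - (N + 1))) ^ j) := by
    intro j
    set b : ℝ := (2 : ℝ) ^ j with hb
    have hb1 : 1 ≤ b := one_le_pow₀ one_le_two
    have hb0 : 0 < b := by positivity
    have hcoef : ∀ k : ℤ, |waveletCoeff ψ g j k| ≤
        (2 : ℝ) ^ (-((j : ℝ) / 2)) * (E * (b⁻¹) ^ (N + 1)) := by
      intro k
      rw [waveletCoeff_eq_integral, abs_mul, abs_of_nonneg (by positivity), Int.cast_natCast,
        zpow_natCast]
      gcongr
      have := abs_integral_sub_moment_le hψ hR hg hC (fun i hi => hmom i hi.le)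
        (b⁻¹ * k) (inv_nonneg.2 hb0.le)
      rw [hmom N le_rfl, mul_zero, sub_zero] at this
      refine this.trans_eq ?_
      rw [mul_pow, hE, hA]
      ring
    set S := Finset.Icc ⌈-(b * T + R)⌉ ⌊b * T + R⌋ with hS
    have hS0 : ∀ k ∉ S, waveletCoeff ψ g j k = 0 := by
      intro k hk
      rw [waveletCoeff_eq_integral, integral_eq_zero_of_ae, mul_zero]
      refine Filter.Eventually.of_forall fun y => ?_
      simp only [Pi.zero_apply, mul_eq_zero, zpow_natCast]
      by_contra! hne
      have h1 : |y| ≤ R := not_lt.1 fun h => hne.2 (hR y h)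
      have h2 : |b⁻¹ * k + b⁻¹ * y| ≤ T := not_lt.1 fun h => hne.1 (hg0 _ h)
      rw [← mul_add, abs_mul, abs_of_pos (inv_pos.2 hb0), inv_mul_le_iff₀ hb0] at h2
      rw [abs_le] at h1 h2
      refine hk (Finset.mem_Icc.2 ⟨Int.ceil_le.2 ?_, Int.le_floor.2 ?_⟩) <;> linarith
    have hcard : (S.card : ℝ) ≤ b * D := by
      have h1 := card_Icc_ceil_floor_le (show -(b * T + R) ≤ b * T + R by
        have : 0 ≤ b * T + R := by positivity
        linarith)
      rw [hD]
      nlinarith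
    have hpow : (S.card : ℝ≥0∞) ^ t ≤ ENNReal.ofReal ((2 : ℝ) ^ ((j : ℝ) * t) * D) := by
      calc (S.card : ℝ≥0∞) ^ t ≤ (ENNReal.ofReal (b * D)) ^ t := by
            gcongr
            rw [← ENNReal.ofReal_natCast]
            exact ENNReal.ofReal_le_ofReal hcard
        _ = ENNReal.ofReal ((b * D) ^ t) := ENNReal.ofReal_rpow_of_nonneg (by positivity) ht0
        _ ≤ _ := by
            refine ENNReal.ofReal_le_ofReal ?_
            rw [Real.mul_rpow hb0.le (by linarith), hb, ← Real.rpow_natCast, ← Real.rpow_mul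
              zero_le_two]
            gcongr
            calc D ^ t ≤ D ^ (1 : ℝ) := Real.rpow_le_rpow_of_exponent_le hD1 ht1
              _ = D := Real.rpow_one D
    calc _ ≤ ENNReal.ofReal ((2 : ℝ) ^ ((j : ℝ) * (s + 1 / 2 - t))) *
          (ENNReal.ofReal ((2 : ℝ) ^ (-((j : ℝ) / 2)) * (E * (b⁻¹) ^ (N + 1))) *
            ENNReal.ofReal ((2 : ℝ) ^ ((j : ℝ) * t) * D)) := by
          gcongr
          exact (eLpNorm_count_le_of_support _ S hS0 hcoef p).trans (by gcongr)
      _ = _ := by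
          rw [← ENNReal.ofReal_mul (by positivity), ← ENNReal.ofReal_mul (by positivity)]
          congr 1
          have h1 : (b⁻¹) ^ (N + 1) = (2 : ℝ) ^ (-((j : ℝ) * (N + 1))) := by
            rw [hb, inv_pow, ← pow_mul, Real.rpow_neg zero_le_two, ← Real.rpow_natCast]
            push_cast
            rfl
          have h2 : ((2 : ℝ) ^ (s - (N + 1))) ^ j = (2 : ℝ) ^ ((s - (N + 1)) * j) := by
            rw [Real.rpow_mul zero_le_two, Real.rpow_natCast]
          have h3 : (2 : ℝ) ^ ((s - (N + 1)) * j) = (2 : ℝ) ^ ((j : ℝ) * (s + 1 / 2 - t)) *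
              (2 : ℝ) ^ (-((j : ℝ) / 2)) * (2 : ℝ) ^ (-((j : ℝ) * (N + 1))) *
              (2 : ℝ) ^ ((j : ℝ) * t) := by
            rw [← Real.rpow_add two_pos, ← Real.rpow_add two_pos, ← Real.rpow_add two_pos]
            congr 1
            ring
          rw [h1, h2, h3]
          ring
  refine (eLpNorm_count_le_tsum _ hq).trans_lt ?_
  simp only [enorm_eq_self]
  refine (ENNReal.tsum_le_tsum hlevel).trans_lt ?_
  refine Summable.tsum_ofReal_lt_top (Summable.mul_left _ (summable_geometric_of_lt_one
    (by positivity) ?_))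
  exact Real.rpow_lt_one_of_one_lt_of_neg one_lt_two (by linarith)

/-! ### The Besov norm of a combination of wavelets at one level -/

theorem waveletCoeff_sum_dyadic (hψ : MemLp ψ 2 volume) {g : ℝ → ℝ} (hg : MemLp g 2 volume)
    {m : ℕ} (c : Fin m → ℝ) (κ : Fin m → ℤ) (j j' k : ℤ) :
    waveletCoeff g (fun x => ∑ i, c i * dyadic ψ j (κ i) x) j' k =
      ∑ i, c i * ∫ x, dyadic ψ j (κ i) x * dyadic g j' k x := by
  have hint : ∀ i, Integrable fun x => c i * (dyadic ψ j (κ i) x * dyadic g j' k x) := fun i =>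
    ((memLp_dyadic hψ j (κ i)).integrable_mul (memLp_dyadic hg j' k)).const_mul (c i)
  simp only [waveletCoeff, Finset.sum_mul, mul_assoc]
  rw [integral_finsetSum _ fun i _ => hint i]
  simp only [integral_const_mul]

/-- By orthonormality the only nonzero coefficients are the `c i`, all at level `j`, so a single
term of the `ℓ^q` sum survives. -/
theorem besovNorm_sum_dyadic_le (hq : 1 ≤ q) (hφ : MemLp φ 2 volume) (hψ : MemLp ψ 2 volume)
    (hMRA : GeneratesMRA φ hφ) (hmother : IsMotherWavelet φ ψ hφ hψ) {m : ℕ} (c : Fin m → ℝ)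
    {γ : ℝ} (hγ : 0 ≤ γ) (hc : ∀ i, |c i| ≤ γ) (κ : Fin m → ℤ) (hκ : Function.Injective κ)
    (j : ℕ) :
    besovNorm φ ψ s p q (fun x => ∑ i, c i * dyadic ψ j (κ i) x) ≤
      ENNReal.ofReal ((2 : ℝ) ^ ((j : ℝ) * (s + 1 / 2 - p.toReal⁻¹)) * γ) *
        (m : ℝ≥0∞) ^ p.toReal⁻¹ := by
  set h : ℝ → ℝ := fun x => ∑ i, c i * dyadic ψ j (κ i) x with hh
  have hφ0 : ∀ k : ℤ, waveletCoeff φ h 0 k = 0 := by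
    intro k
    rw [hh, waveletCoeff_sum_dyadic hψ hφ]
    refine Finset.sum_eq_zero fun i _ => ?_
    rw [hmother.integral_mul_father hMRA (by positivity), mul_zero]
  have hψ0 : ∀ j' : ℕ, j' ≠ j → ∀ k : ℤ, waveletCoeff ψ h j' k = 0 := by
    intro j' hj k
    rw [hh, waveletCoeff_sum_dyadic hψ hψ]
    refine Finset.sum_eq_zero fun i _ => ?_
    rw [hmother.integral_mul_of_ne hMRA (by exact_mod_cast hj.symm), mul_zero]
  have hψj : ∀ k : ℤ, waveletCoeff ψ h j k = ∑ i, c i * if κ i = k then 1 else 0 := by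
    intro k
    rw [hh, waveletCoeff_sum_dyadic hψ hψ]
    simp only [hmother.integral_mul_self_level]
  have hS0 : ∀ k ∉ Finset.univ.image κ, waveletCoeff ψ h j k = 0 := by
    intro k hk
    rw [hψj]
    refine Finset.sum_eq_zero fun i _ => ?_
    rw [if_neg, mul_zero]
    rintro rfl
    exact hk (Finset.mem_image_of_mem _ (Finset.mem_univ _))
  have hle : ∀ k : ℤ, |waveletCoeff ψ h j k| ≤ γ := by
    intro k
    by_cases hk : k ∈ Finset.univ.image κ
    · obtain ⟨i, -, rfl⟩ := Finset.mem_image.1 hk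
      rw [hψj, Finset.sum_eq_single i]
      · simpa using hc i
      · intro l _ hl
        rw [if_neg (hκ.ne hl), mul_zero]
      · simp
    · rw [hS0 k hk, abs_zero]; exact hγ
  have hlev := eLpNorm_count_le_of_support (fun k => waveletCoeff ψ h j k) _ hS0 hle p
  rw [Finset.card_image_of_injective _ hκ, Finset.card_univ, Fintype.card_fin] at hlev
  rw [besovNorm]
  simp only [hφ0]
  rw [eLpNorm_zero', zero_add]
  refine (eLpNorm_count_le_tsum _ hq).trans ?_
  rw [tsum_eq_single j]
  · simp only [enorm_eq_self]
    rw [ENNReal.ofReal_mul (by positivity), mul_assoc]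
    gcongr
  · intro j' hj
    simp [hψ0 j' hj]

end

theorem integrable_dyadic {g : ℝ → ℝ} (hg : Integrable g) (j k : ℤ) : Integrable (dyadic g j k) :=
  ((hg.comp_sub_right (k : ℝ)).comp_mul_left' (zpow_ne_zero j two_ne_zero)).const_mul _

theorem integral_dyadic (g : ℝ → ℝ) (j k : ℤ) :
    ∫ x, dyadic g j k x = (2 : ℝ) ^ ((j : ℝ) / 2) * (((2 : ℝ) ^ j)⁻¹ * ∫ y, g y) := by
  simp only [dyadic]
  rw [integral_const_mul, integral_comp_dyadic g]

/-! ### A density in the interior of the class that is bounded below -/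

/-- A smooth bump on `[-T, T]` equal to its maximum on `[-T/2, T/2]`. -/
def wideBump {T : ℝ} (hT : 0 < T) : ContDiffBump (0 : ℝ) where
  rIn := T / 2
  rOut := T
  rIn_pos := half_pos hT
  rIn_lt_rOut := half_lt_self hT

theorem exists_measurable_density {φ ψ : ℝ → ℝ} {s : ℝ} {p q : ℝ≥0∞} {L T : ℝ} {f : ℝ → ℝ}
    (hf : f ∈ densityBesov φ ψ s p q L T) :
    ∃ f' ∈ densityBesov φ ψ s p q L T, Measurable f' := by
  obtain ⟨hi, h0, h1, hs, hb⟩ := hf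
  have hm := hi.aestronglyMeasurable
  set f' : ℝ → ℝ := (Set.Icc (-T) T).indicator fun x => max 0 (hm.mk f x) with hf'
  have hmeas : Measurable f' :=
    (measurable_const.max hm.stronglyMeasurable_mk.measurable).indicator measurableSet_Icc
  have hae : f =ᵐ[volume] f' := by
    filter_upwards [hm.ae_eq_mk] with x hx
    by_cases hxT : x ∈ Set.Icc (-T) T
    · rw [hf', Set.indicator_of_mem hxT, ← hx, max_eq_right (h0 x)]
    · rw [hf', Set.indicator_of_notMem hxT]
      by_contra hne
      exact hxT (hs (subset_tsupport _ hne))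
  refine ⟨f', ⟨hi.congr hae, fun x => ?_, ?_, ?_, ?_⟩, hmeas⟩
  · exact Set.indicator_nonneg (fun x _ => le_max_left _ _) x
  · rw [← integral_congr_ae hae, h1]
  · exact closure_minimal Set.support_indicator_subset isClosed_Icc
  · rwa [← besovNorm_congr_ae_right hae]

/-- The mixture `(1 - ε) f + ε g` with a bump `g` is bounded below where `g` is constant. Since `f`
has norm at most `L' < L` and `g` has finite norm, a small `ε` leaves room `c₁` for perturbations.
-/
theorem exists_base_density {φ ψ : ℝ → ℝ} {s : ℝ} {p q : ℝ≥0∞} (hp : 1 ≤ p) (hq : 1 ≤ q)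
    {N : ℕ} (hsN : s < N + 1) (hφ : Integrable φ) {B : ℝ} (hB : ∀ᵐ x, |φ x| ≤ B)
    (hψ : Integrable ψ) {B' : ℝ} (hB' : ∀ᵐ x, |ψ x| ≤ B') {R : ℝ} (hR0 : 0 ≤ R)
    (hR : ∀ x, R < |x| → ψ x = 0) (hmom : ∀ l ≤ N, ∫ y, y ^ l * ψ y = 0)
    {L T : ℝ} (hL : 0 < L) (hT : 0 < T)
    (hne : ∃ L' < L, (densityBesov φ ψ s p q L' T).Nonempty) :
    ∃ b : ℝ → ℝ, Measurable b ∧ Integrable b ∧ (∀ x, 0 ≤ b x) ∧ ∫ x, b x = 1 ∧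
      (∀ x, T < |x| → b x = 0) ∧ (∃ c₀, 0 < c₀ ∧ ∀ x, |x| ≤ T / 2 → c₀ ≤ b x) ∧
      ∃ c₁, 0 < c₁ ∧ besovNorm φ ψ s p q b + ENNReal.ofReal c₁ ≤ ENNReal.ofReal L := by
  obtain ⟨L', hL', f₁, hf₁⟩ := hne
  obtain ⟨f, ⟨hfi, hf0, hf1, hfs, hfb⟩, hfm⟩ := exists_measurable_density hf₁
  set g := (wideBump hT).normed (volume : Measure ℝ) with hg
  have hgs : ContDiff ℝ ∞ g := (wideBump hT).contDiff_normed
  have hgc : HasCompactSupport g := (wideBump hT).hasCompactSupport_normed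
  have hgJ : besovNorm φ ψ s p q g < ⊤ :=
    besovNorm_lt_top_of_contDiff hp hq hsN hφ hψ hR0 hR hmom hgs hgc
  set G := (besovNorm φ ψ s p q g).toReal with hG
  have hG0 : 0 ≤ G := ENNReal.toReal_nonneg
  -- A negative `L'` acts as zero under `ENNReal.ofReal`; truncation makes the real arithmetic
  -- agree.
  set L₁ := max L' 0
  have hL₁ : L₁ < L := max_lt hL' hL
  have hL₁0 : 0 ≤ L₁ := le_max_right _ _
  set ε := min 1 ((L - L₁) / (2 * (G + 1))) with hε
  have hε0 : 0 < ε := lt_min one_pos (div_pos (by linarith) (by positivity))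
  have hε1 : ε ≤ 1 := min_le_left _ _
  have hεG : ε * G ≤ (L - L₁) / 2 := by
    calc ε * G ≤ (L - L₁) / (2 * (G + 1)) * (G + 1) := by
          have h1 : ε ≤ (L - L₁) / (2 * (G + 1)) := min_le_right _ _
          have h2 : 0 ≤ (L - L₁) / (2 * (G + 1)) := hε0.le.trans h1
          nlinarith
      _ = (L - L₁) / 2 := by field_simp
  have hgi : Integrable g := (wideBump hT).integrable_normed
  refine ⟨fun x => (1 - ε) * f x + ε * g x, ?_, ?_, ?_, ?_, ?_, ?_, (L - L₁) / 2, ?_, ?_⟩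
  · exact (hfm.const_mul _).add (hgs.continuous.measurable.const_mul _)
  · exact (hfi.const_mul _).add (hgi.const_mul _)
  · intro x
    have := hf0 x
    have := (wideBump hT).nonneg_normed (μ := volume) x
    have : 0 ≤ 1 - ε := by linarith
    positivity
  · rw [integral_add (hfi.const_mul _) (hgi.const_mul _), integral_const_mul, integral_const_mul,
      hf1, hg, ContDiffBump.integral_normed]
    ring
  · intro x hx
    have h1 : f x = 0 := by
      by_contra hne
      have := hfs (subset_tsupport _ hne)
      rw [Set.mem_Icc, ← abs_le] at this
      linarith
    have h2 : g x = 0 := by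
      have : x ∉ Function.support g := by
        rw [hg, ContDiffBump.support_normed_eq, Metric.mem_ball, dist_zero_right,
          Real.norm_eq_abs]
        exact not_lt.2 hx.le
      exact Function.notMem_support.1 this
    simp only [h1, h2]
    ring
  · refine ⟨ε * (1 / ∫ x, wideBump hT x), ?_, fun x hx => ?_⟩
    · have := (wideBump hT).integral_pos (μ := (volume : Measure ℝ))
      positivity
    · have h1 : g x = 1 / ∫ x, wideBump hT x := by
        rw [hg, ContDiffBump.normed_def, ContDiffBump.one_of_mem_closedBall]
        rw [mem_closedBall_zero_iff, Real.norm_eq_abs]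
        exact hx
      simp only [h1]
      have := mul_nonneg (show 0 ≤ 1 - ε by linarith) (hf0 x)
      linarith
  · linarith
  · have h1 := besovNorm_add_le (s := s) hp hq hφ.aestronglyMeasurable hψ.aestronglyMeasurable
      hB hB' (hfi.const_mul (1 - ε)) (hgi.const_mul ε)
    have h2 := besovNorm_const_mul_le (φ := φ) (ψ := ψ) (s := s) (p := p) (q := q)
      (show 0 ≤ 1 - ε by linarith) f
    have h3 := besovNorm_const_mul_le (φ := φ) (ψ := ψ) (s := s) (p := p) (q := q) hε0.le g
    have h4 : besovNorm φ ψ s p q f ≤ ENNReal.ofReal L₁ :=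
      hfb.trans (ENNReal.ofReal_le_ofReal (le_max_left _ _))
    have h5 : besovNorm φ ψ s p q g = ENNReal.ofReal G := (ENNReal.ofReal_toReal hgJ.ne).symm
    calc _ ≤ ENNReal.ofReal (1 - ε) * ENNReal.ofReal L₁ + ENNReal.ofReal ε * ENNReal.ofReal G +
          ENNReal.ofReal ((L - L₁) / 2) := by
          gcongr
          refine h1.trans (add_le_add (h2.trans ?_) (h3.trans ?_))
          · gcongr
          · rw [h5]
      _ = ENNReal.ofReal ((1 - ε) * L₁ + ε * G + (L - L₁) / 2) := by
          have e1 : 0 ≤ (1 - ε) * L₁ := mul_nonneg (by linarith) hL₁0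
          have e2 : 0 ≤ ε * G := by positivity
          rw [← ENNReal.ofReal_mul (by linarith), ← ENNReal.ofReal_mul hε0.le,
            ← ENNReal.ofReal_add e1 e2, ← ENNReal.ofReal_add (by linarith) (by linarith)]
      _ ≤ ENNReal.ofReal L := by
          refine ENNReal.ofReal_le_ofReal ?_
          nlinarith

/-! ### The hypercube of perturbed densities -/

section

variable {ψ : ℝ → ℝ} {R : ℕ}

/-- Shifts for which the wavelets supported in `[-R, R]` have disjoint supports. -/
def spacedShift (R : ℕ) {m : ℕ} (i : Fin m) : ℤ := 3 * R * (i : ℕ)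

theorem spacedShift_injective (hR : 1 ≤ R) {m : ℕ} :
    Function.Injective (spacedShift R : Fin m → ℤ) := by
  intro a b h
  have hR' : (3 * R : ℤ) ≠ 0 := by positivity
  have := mul_left_cancel₀ hR' h
  exact Fin.ext (by exact_mod_cast this)

theorem le_abs_spacedShift_sub (R : ℕ) {m : ℕ} {i l : Fin m} (h : i ≠ l) :
    (3 * R : ℝ) ≤ |(spacedShift R i : ℝ) - spacedShift R l| := by
  simp only [spacedShift]
  push_cast
  rw [← mul_sub, abs_mul, abs_of_nonneg (by positivity)]
  have h1 : ((i : ℕ) : ℤ) - ((l : ℕ) : ℤ) ≠ 0 := by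
    rw [sub_ne_zero]
    exact fun h' => h (Fin.ext (by exact_mod_cast h'))
  have h2 : (1 : ℝ) ≤ |((i : ℕ) : ℝ) - ((l : ℕ) : ℝ)| := by
    have := Int.one_le_abs h1
    exact_mod_cast this
  nlinarith [(Nat.cast_nonneg R : (0 : ℝ) ≤ R)]

/-- The interval carrying the wavelet of level `j` and shift number `i`. -/
def cell (R : ℕ) (j : ℤ) {m : ℕ} (i : Fin m) : Set ℝ :=
  {x | |(2 : ℝ) ^ j * x - spacedShift R i| ≤ R}

theorem measurableSet_cell (R : ℕ) (j : ℤ) {m : ℕ} (i : Fin m) : MeasurableSet (cell R j i) :=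
  (isClosed_le (by fun_prop) continuous_const).measurableSet

/-- In the rescaled variable the cells have radius `R` and their centres are at least `3R > 2R`
apart; `R ≥ 1` makes the gap strict. -/
theorem notMem_cell_of_ne (hR : 1 ≤ R) {j : ℤ} {m : ℕ} {i l : Fin m} (h : i ≠ l) {x : ℝ}
    (hx : x ∈ cell R j i) : x ∉ cell R j l := by
  intro hx'
  simp only [cell, Set.mem_ofPred_eq] at hx hx'
  have h1 := le_abs_spacedShift_sub R h
  have h2 := abs_sub ((2 : ℝ) ^ j * x - spacedShift R l) ((2 : ℝ) ^ j * x - spacedShift R i)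
  have h3 : ((2 : ℝ) ^ j * x - spacedShift R l) - ((2 : ℝ) ^ j * x - spacedShift R i) =
      (spacedShift R i : ℝ) - spacedShift R l := by ring
  rw [h3] at h2
  have : (1 : ℝ) ≤ R := by exact_mod_cast hR
  linarith

theorem dyadic_eq_zero_of_notMem_cell (hψR : ∀ x : ℝ, R < |x| → ψ x = 0) {j : ℤ} {m : ℕ}
    {i : Fin m} {x : ℝ} (hx : x ∉ cell R j i) : dyadic ψ j (spacedShift R i) x = 0 := by
  rw [dyadic, hψR _ (not_le.1 hx), mul_zero]

theorem sum_dyadic_of_mem_cell (hψR : ∀ x : ℝ, R < |x| → ψ x = 0) (hR : 1 ≤ R) {j : ℤ} {m : ℕ}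
    (c : Fin m → ℝ) {i : Fin m} {x : ℝ} (hx : x ∈ cell R j i) :
    ∑ l, c l * dyadic ψ j (spacedShift R l) x = c i * dyadic ψ j (spacedShift R i) x := by
  refine Finset.sum_eq_single i (fun l _ hl => ?_) (by simp)
  rw [dyadic_eq_zero_of_notMem_cell hψR (notMem_cell_of_ne hR hl.symm hx), mul_zero]

theorem sum_dyadic_of_notMem_cell (hψR : ∀ x : ℝ, R < |x| → ψ x = 0) {j : ℤ} {m : ℕ}
    (c : Fin m → ℝ) {x : ℝ} (hx : ∀ i : Fin m, x ∉ cell R j i) :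
    ∑ l, c l * dyadic ψ j (spacedShift R l) x = 0 :=
  Finset.sum_eq_zero fun l _ => by
    rw [dyadic_eq_zero_of_notMem_cell hψR (hx l), mul_zero]

/-- The minimax bound obtained from the hypercube of wavelet perturbations of a base density. -/
theorem le_privateMinimaxRisk_of_wavelets {φ : ℝ → ℝ} {hφ2 : MemLp φ 2 volume}
    {hψ2 : MemLp ψ 2 volume} (hMRA : GeneratesMRA φ hφ2) (hmother : IsMotherWavelet φ ψ hφ2 hψ2)
    {s : ℝ} {p q : ℝ≥0∞} (hp : 1 ≤ p) (hq : 1 ≤ q) {A' : ℝ} (hA' : ∀ᵐ x, |φ x| ≤ A')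
    (hψm : Measurable ψ) (hψi : Integrable ψ) {B : ℝ} (hB : ∀ x, |ψ x| ≤ B) (hR : 1 ≤ R)
    (hψR : ∀ x : ℝ, R < |x| → ψ x = 0) (hψ0 : ∫ y, ψ y = 0) {L T : ℝ}
    {b : ℝ → ℝ} (hbm : Measurable b) (hbi : Integrable b) (hb0 : ∀ x, 0 ≤ b x)
    (hb1 : ∫ x, b x = 1) (hbT : ∀ x, T < |x| → b x = 0) {c₀ c₁ : ℝ}
    (hc₀ : ∀ x, |x| ≤ T / 2 → c₀ ≤ b x) (hT : 0 < T)
    (hc₁ : besovNorm φ ψ s p q b + ENNReal.ofReal c₁ ≤ ENNReal.ofReal L)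
    {m j : ℕ} {γ : ℝ} (hγ : 0 ≤ γ) (hγB : γ * ((2 : ℝ) ^ (((j : ℤ) : ℝ) / 2) * B) ≤ c₀)
    (hcell : ∀ (i : Fin m), ∀ x ∈ cell R j i, |x| ≤ T / 2)
    (hγc₁ : ENNReal.ofReal ((2 : ℝ) ^ ((j : ℝ) * (s + 1 / 2 - p.toReal⁻¹)) * γ) *
      (m : ℝ≥0∞) ^ p.toReal⁻¹ ≤ ENNReal.ofReal c₁)
    {α : ℝ} (hα : 0 < α) {n : ℕ} {r : ℝ} (hr : 1 ≤ r) (δ : ℝ≥0)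
    (hδ : (Real.exp α - 1) * (2 * γ * ((2 : ℝ) ^ (((j : ℤ) : ℝ) / 2) *
      (((2 : ℝ) ^ (j : ℤ))⁻¹ * ∫ y, |ψ y|))) ≤ δ)
    (hδn : (1 + (δ : ℝ≥0∞) ^ 2) ^ n ≤ 2) :
    m * ENNReal.ofReal ((γ * (2 : ℝ) ^ (((j : ℤ) : ℝ) / 2)) ^ r *
      (((2 : ℝ) ^ (j : ℤ))⁻¹ * ∫ y, |ψ y| ^ r)) ≤
      4 * privateMinimaxRisk.{u} α n r (densityBesov φ ψ s p q L T) := by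
  set Q : ℝ := (2 : ℝ) ^ (((j : ℤ) : ℝ) / 2) with hQ
  have hQ0 : 0 ≤ Q := by positivity
  have hr0 : r ≠ 0 := by linarith
  set d : Fin m → ℝ → ℝ := fun i => dyadic ψ j (spacedShift R i) with hd
  have hdi : ∀ i, Integrable (d i) := fun i => integrable_dyadic hψi _ _
  have hdm : ∀ i, Measurable (d i) := fun i => by
    simp only [hd]
    unfold dyadic
    fun_prop
  have hdB : ∀ i x, |d i x| ≤ Q * B := fun i x => by
    simp only [hd, dyadic]
    rw [abs_mul, abs_of_nonneg hQ0]
    gcongr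
    exact hB _
  set h : (Fin m → Bool) → ℝ → ℝ := fun σ x => ∑ i, γ * bitSign (σ i) * d i x with hh
  have hhi : ∀ σ, Integrable (h σ) := fun σ =>
    integrable_finsetSum _ fun i _ => (hdi i).const_mul _
  have hin : ∀ σ i, ∀ x ∈ cell R j i, h σ x = γ * bitSign (σ i) * d i x := fun σ i x hx =>
    sum_dyadic_of_mem_cell hψR hR (fun i => γ * bitSign (σ i)) hx
  have hout : ∀ σ x, (∀ i : Fin m, x ∉ cell R j i) → h σ x = 0 := fun σ x hx =>
    sum_dyadic_of_notMem_cell hψR (fun i => γ * bitSign (σ i)) hx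
  have hcoef : ∀ (σ : Fin m → Bool) i, |γ * bitSign (σ i)| ≤ γ := fun σ i => by
    rw [abs_mul, abs_bitSign, mul_one, abs_of_nonneg hγ]
  -- On a cell the perturbation is at most `γ Q B ≤ c₀ ≤ b x` in absolute value; off the cells it is
  -- zero.
  have hf0 : ∀ σ x, 0 ≤ b x + h σ x := by
    intro σ x
    by_cases hx : ∃ i : Fin m, x ∈ cell R j i
    · obtain ⟨i, hi⟩ := hx
      rw [hin σ i x hi]
      have h1 := hc₀ x (hcell i x hi)
      have h2 : |γ * bitSign (σ i) * d i x| ≤ γ * (Q * B) := by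
        rw [abs_mul]
        exact mul_le_mul (hcoef σ i) (hdB i x) (abs_nonneg _) hγ
      have h3 := neg_abs_le (γ * bitSign (σ i) * d i x)
      linarith
    · push Not at hx
      rw [hout σ x hx, add_zero]
      exact hb0 x
  have hfi : ∀ σ, Integrable fun x => b x + h σ x := fun σ => hbi.add (hhi σ)
  have hf1 : ∀ σ, ∫ x, b x + h σ x = 1 := by
    intro σ
    rw [integral_add hbi (hhi σ), hb1]
    simp only [hh]
    rw [integral_finsetSum _ fun i _ => (hdi i).const_mul _, Finset.sum_eq_zero, add_zero]
    intro i _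
    rw [integral_const_mul, hd, integral_dyadic, hψ0]
    simp
  have hmem : ∀ σ, (fun x => b x + h σ x) ∈ densityBesov φ ψ s p q L T := by
    intro σ
    refine ⟨hfi σ, hf0 σ, hf1 σ, closure_minimal (fun x hx => ?_) isClosed_Icc, ?_⟩
    · rw [Set.mem_Icc, ← abs_le]
      by_contra! hlt
      refine hx ?_
      simp only
      rw [hbT x hlt, hout σ x fun i hi => ?_, add_zero]
      have := hcell i x hi
      linarith
    · refine (besovNorm_add_le hp hq hφ2.1 hψ2.1 hA' (Filter.Eventually.of_forall hB)
        hbi (hhi σ)).trans (le_trans ?_ hc₁)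
      gcongr
      exact (besovNorm_sum_dyadic_le hq hφ2 hψ2 hMRA hmother _ hγ (hcoef σ) _
        (spacedShift_injective hR) j).trans hγc₁
  have hdist : ∀ σ i, ∫ x, |(b x + h σ x) - (b x + h (flipAt i σ) x)| =
      2 * γ * (Q * (((2 : ℝ) ^ (j : ℤ))⁻¹ * ∫ y, |ψ y|)) := by
    intro σ i
    have e : ∀ x, |(b x + h σ x) - (b x + h (flipAt i σ) x)| =
        2 * γ * dyadic (fun y => |ψ y|) j (spacedShift R i) x := by
      intro x
      -- The densities differ in one summand only, by twice its size.
      have e1 : (b x + h σ x) - (b x + h (flipAt i σ) x) = 2 * γ * bitSign (σ i) * d i x := by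
        rw [add_sub_add_left_eq_sub, hh, ← Finset.sum_sub_distrib, Finset.sum_eq_single i]
        · rw [flipAt_self]
          cases σ i <;> simp [bitSign] <;> ring
        · intro l _ hl
          rw [flipAt_of_ne hl, sub_self]
        · simp
      rw [e1, abs_mul, abs_mul, abs_bitSign, mul_one, abs_of_nonneg (by positivity)]
      simp only [hd, dyadic]
      rw [abs_mul, abs_of_nonneg hQ0]
    simp_rw [e]
    rw [integral_const_mul, integral_dyadic]
  refine le_privateMinimaxRisk_of_hypercube hα n (by linarith) _ (fun σ x => b x + h σ x) hmem
    hfi hf0 hf1 (fun i => cell R j i) (fun i => measurableSet_cell R j i) ?_ b hbm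
    (fun i x => γ * d i x) (fun i => (hdm i).const_mul _) ?_ δ ?_ hδn ENNReal.ofReal_ne_top ?_
  · intro i l hil
    exact Set.disjoint_left.2 fun x hx => notMem_cell_of_ne hR hil hx
  · intro σ i x hx
    rw [hin σ i x hx]
    ring
  · intro σ i
    rw [hdist]
    exact hδ
  · intro i
    have e : ∀ x, |γ * d i x| ^ r = (γ * Q) ^ r *
        (fun y => |ψ y| ^ r) ((2 : ℝ) ^ (j : ℤ) * x - spacedShift R i) := by
      intro x
      simp only [hd, dyadic]
      rw [← mul_assoc, abs_mul, abs_of_nonneg (mul_nonneg hγ hQ0),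
        Real.mul_rpow (mul_nonneg hγ hQ0) (abs_nonneg _)]
    have hint : Integrable fun x => |γ * d i x| ^ r := by
      have hm : Measurable fun x => |γ * d i x| ^ r :=
        ((hdm i).const_mul γ).abs.pow_const r
      refine ((hdi i).abs.const_mul ((γ * (Q * B)) ^ (r - 1) * γ)).mono' hm.aestronglyMeasurable
        (Filter.Eventually.of_forall fun x => ?_)
      rw [Real.norm_eq_abs, abs_of_nonneg (by positivity)]
      have hsp : |γ * d i x| ^ r = |γ * d i x| ^ (r - 1) * |γ * d i x| := by
        rcases eq_or_ne (|γ * d i x|) 0 with h0 | h0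
        · rw [h0, Real.zero_rpow hr0, mul_zero]
        · rw [← Real.rpow_add_one h0, sub_add_cancel]
      have hle : |γ * d i x| ≤ γ * (Q * B) := by
        rw [abs_mul, abs_of_nonneg hγ]
        exact mul_le_mul_of_nonneg_left (hdB i x) hγ
      calc |γ * d i x| ^ r = |γ * d i x| ^ (r - 1) * |γ * d i x| := hsp
        _ ≤ (γ * (Q * B)) ^ (r - 1) * |γ * d i x| := by
            gcongr
        _ = _ := by rw [abs_mul, abs_of_nonneg hγ]; ring
    have hI : ∫ x, |γ * d i x| ^ r = (γ * Q) ^ r * (((2 : ℝ) ^ (j : ℤ))⁻¹ * ∫ y, |ψ y| ^ r) := by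
      simp_rw [e]
      rw [integral_const_mul, integral_comp_dyadic (fun y => |ψ y| ^ r)]
    rw [← hI, ← setIntegral_eq_integral_of_forall_compl_eq_zero (s := cell R j i),
      ofReal_integral_eq_lintegral_ofReal hint.integrableOn
        (Filter.Eventually.of_forall fun x => by positivity)]
    intro x hx
    simp only [hd]
    rw [dyadic_eq_zero_of_notMem_cell hψR hx, mul_zero, abs_zero, Real.zero_rpow hr0]

end

/-! ### Choice of level and amplitude -/

theorem one_add_sq_pow_le_two {δ : ℝ≥0} {n : ℕ} (h : n * (δ : ℝ) ^ 2 ≤ 1 / 4) :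
    (1 + (δ : ℝ≥0∞) ^ 2) ^ n ≤ 2 := by
  have h1 : (1 + (δ : ℝ) ^ 2) ^ n ≤ 2 := by
    calc (1 + (δ : ℝ) ^ 2) ^ n ≤ Real.exp ((δ : ℝ) ^ 2) ^ n := by
          gcongr
          linarith [Real.add_one_le_exp ((δ : ℝ) ^ 2)]
      _ = Real.exp (n * (δ : ℝ) ^ 2) := by rw [← Real.exp_nat_mul]
      _ ≤ Real.exp (Real.log 2) := by
          refine Real.exp_le_exp.2 ?_
          linarith [Real.log_two_gt_d9]
      _ = 2 := Real.exp_log two_pos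
  exact_mod_cast h1

theorem exists_pow_two_near {y : ℝ} (hy : 1 ≤ y) : ∃ i : ℕ, y ≤ 2 ^ i ∧ (2 : ℝ) ^ i ≤ 2 * y := by
  obtain ⟨n, h1, h2⟩ := exists_nat_pow_near hy one_lt_two
  refine ⟨n + 1, h2.le, ?_⟩
  rw [pow_succ]
  linarith

/-- The private minimax lower bound for a bounded measurable wavelet with vanishing moments. -/
theorem exists_private_lower_bound_of_moments {φ ψ : ℝ → ℝ} {hφ2 : MemLp φ 2 volume}
    {hψ2 : MemLp ψ 2 volume} (hMRA : GeneratesMRA φ hφ2) (hmother : IsMotherWavelet φ ψ hφ2 hψ2)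
    {N : ℕ} {s : ℝ} (hs : 0 < s) (hsN : s < N + 1) {p q : ℝ≥0∞} (hp : 1 ≤ p) (hq : 1 ≤ q)
    (hφ : Integrable φ) {A' : ℝ} (hA' : ∀ᵐ x, |φ x| ≤ A') (hψm : Measurable ψ) {B : ℝ}
    (hB : ∀ x, |ψ x| ≤ B) {R : ℕ} (hR : 1 ≤ R) (hψR : ∀ x : ℝ, R < |x| → ψ x = 0)
    (hψi : Integrable ψ) (hψne : ¬ ψ =ᵐ[volume] 0) (hmom : ∀ l ≤ N, ∫ y, y ^ l * ψ y = 0)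
    {r : ℝ} (hr : 1 ≤ r) {L T : ℝ} (hL : 0 < L) (hT : 0 < T)
    (hne : ∃ L' < L, (densityBesov φ ψ s p q L' T).Nonempty) :
    ∃ C : ℝ, 0 < C ∧ ∀ α : ℝ, 0 < α → ∀ n : ℕ, 1 ≤ n * (Real.exp α - 1) ^ 2 →
      ENNReal.ofReal (C * (n * (Real.exp α - 1) ^ 2) ^ (-(r * s / (2 * s + 2)))) ≤
        privateMinimaxRisk.{u} α n r (densityBesov φ ψ s p q L T) := by
  obtain ⟨b, hbm, hbi, hb0, hb1, hbT, ⟨c₀, hc₀, hbc₀⟩, c₁, hc₁, hbJ⟩ :=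
    exists_base_density hp hq hsN hφ hA' hψi (Filter.Eventually.of_forall hB) R.cast_nonneg hψR
      hmom hL hT hne
  have hB0 : 0 ≤ B := (abs_nonneg _).trans (hB 0)
  set A := ∫ y, |ψ y| with hA
  have hA0 : 0 ≤ A := integral_nonneg fun y => abs_nonneg _
  set W := ∫ y, |ψ y| ^ r with hW
  have hψr : Integrable fun y => |ψ y| ^ r := by
    refine (hψi.abs.const_mul (B ^ (r - 1))).mono' (hψm.abs.pow_const r).aestronglyMeasurable
      (Filter.Eventually.of_forall fun y => ?_)
    rw [Real.norm_eq_abs, abs_of_nonneg (by positivity)]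
    rcases eq_or_ne (|ψ y|) 0 with h0 | h0
    · rw [h0, Real.zero_rpow (by linarith), mul_zero]
    · calc |ψ y| ^ r = |ψ y| ^ (r - 1) * |ψ y| := by rw [← Real.rpow_add_one h0, sub_add_cancel]
        _ ≤ B ^ (r - 1) * |ψ y| := by
            gcongr
            exact hB y
  have hW0 : 0 < W := by
    refine lt_of_le_of_ne (integral_nonneg fun y => by positivity) fun h0 => hψne ?_
    have h1 := (integral_eq_zero_iff_of_nonneg (fun y => by positivity) hψr).1 h0.symm
    filter_upwards [h1] with y hy
    simp only [Pi.zero_apply] at hy ⊢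
    rw [Real.rpow_eq_zero (abs_nonneg _) (by linarith), abs_eq_zero] at hy
    exact hy
  -- The three bounds serve positivity (`c B ≤ c₀`), the Besov norm (`c ≤ c₁`) and chi-square
  -- closeness (`c A ≤ 1/4`).
  set c := min (min (c₀ / (B + 1)) c₁) (1 / (4 * (A + 1))) with hc
  have hc0 : 0 < c := by positivity
  have hcB : c * B ≤ c₀ := by
    have h1 : c ≤ c₀ / (B + 1) := (min_le_left _ _).trans (min_le_left _ _)
    rw [le_div_iff₀ (by positivity)] at h1
    linarith
  have hcc₁ : c ≤ c₁ := (min_le_left _ _).trans (min_le_right _ _)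
  have hcA : c * A ≤ 1 / 4 := by
    have h1 : c ≤ 1 / (4 * (A + 1)) := min_le_right _ _
    rw [le_div_iff₀ (by positivity)] at h1
    linarith
  -- A fixed number `J` of extra levels shrinks the cells: `2^i` of them at level `i + J` reach at
  -- most `3R / 2^J < T / 2` from the origin.
  obtain ⟨J, hJ⟩ := pow_unbounded_of_one_lt (6 * R / T) (one_lt_two (α := ℝ))
  set K : ℝ := 2 ^ J with hK
  have hK0 : 0 < K := by positivity
  have hK1 : 1 ≤ K := one_le_pow₀ one_le_two
  refine ⟨c ^ r * K ^ (-(s * r)) * K⁻¹ * W * 2 ^ (-(s * r)) / 4, by positivity,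
    fun α hα n hE => ?_⟩
  have he : 0 < Real.exp α - 1 := by linarith [Real.add_one_lt_exp hα.ne']
  set E : ℝ := n * (Real.exp α - 1) ^ 2 with hEdef
  have hE0 : 0 < E := by linarith
  set y := E ^ (1 / (2 * s + 2)) with hy
  have hy1 : 1 ≤ y := Real.one_le_rpow hE (by positivity)
  have hyE : y ^ (2 * s + 2) = E := by
    rw [hy, ← Real.rpow_mul hE0.le, one_div_mul_cancel (by linarith), Real.rpow_one]
  -- The lower bound on `2^i` keeps neighbouring laws close; the upper bound gives the rate.
  obtain ⟨i, hi1, hi2⟩ := exists_pow_two_near hy1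
  set v : ℝ := 2 ^ i with hv
  have hv0 : 0 < v := by positivity
  have hv1 : 1 ≤ v := hy1.trans hi1
  set j := i + J with hj
  set D : ℝ := 2 ^ j with hD
  have hDv : D = v * K := by rw [hD, hj, pow_add]
  have hD0 : 0 < D := by positivity
  have hD1 : 1 ≤ D := one_le_pow₀ one_le_two
  have hvD : v ≤ D := by rw [hDv]; exact le_mul_of_one_le_right hv0.le hK1
  have hQ : (2 : ℝ) ^ (((j : ℤ) : ℝ) / 2) = D ^ (1 / 2 : ℝ) := by
    rw [hD, ← Real.rpow_natCast, ← Real.rpow_mul zero_le_two, Int.cast_natCast]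
    congr 1
    ring
  have hDz : (2 : ℝ) ^ (j : ℤ) = D := zpow_natCast _ _
  set γ := c * D ^ (-(s + 1 / 2)) with hγ
  have hγ0 : 0 ≤ γ := by positivity
  have hγQ : γ * D ^ (1 / 2 : ℝ) = c * D ^ (-s) := by
    rw [hγ, mul_assoc, ← Real.rpow_add hD0]
    congr 2
    ring
  have hDs : D ^ (-s) ≤ 1 := Real.rpow_le_one_of_one_le_of_nonpos hD1 (by linarith)
  have hδ0 : 0 ≤ (Real.exp α - 1) * (2 * γ * (D ^ (1 / 2 : ℝ) * (D⁻¹ * A))) := by positivity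
  have hED : E ≤ D ^ (2 * s + 2) := by
    rw [← hyE]
    exact Real.rpow_le_rpow (by linarith) (hi1.trans hvD) (by linarith)
  have hδn : (n : ℝ) *
      ((Real.exp α - 1) * (2 * γ * (D ^ (1 / 2 : ℝ) * (D⁻¹ * A)))) ^ 2 ≤ 1 / 4 := by
    have e1 : 2 * γ * (D ^ (1 / 2 : ℝ) * (D⁻¹ * A)) = 2 * (c * A) * D ^ (-(s + 1)) := by
      have : D ^ (-(s + 1)) = D ^ (-s) * D⁻¹ := by
        rw [neg_add, Real.rpow_add hD0, Real.rpow_neg_one]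
      rw [this]
      linear_combination (2 * D⁻¹ * A) * hγQ
    have e2 : (D ^ (-(s + 1))) ^ 2 = (D ^ (2 * s + 2))⁻¹ := by
      rw [← Real.rpow_natCast, ← Real.rpow_mul hD0.le, ← Real.rpow_neg hD0.le]
      congr 1
      push_cast
      ring
    -- This is the balance that fixes the level: `n δ²` is a constant multiple of `E / D^{2s+2}`.
    have e3 : (n : ℝ) * ((Real.exp α - 1) * (2 * γ * (D ^ (1 / 2 : ℝ) * (D⁻¹ * A)))) ^ 2 =
        4 * (c * A) ^ 2 * (E * (D ^ (2 * s + 2))⁻¹) := by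
      rw [e1, mul_pow, mul_pow, e2, hEdef]
      ring
    have e4 : E * (D ^ (2 * s + 2))⁻¹ ≤ 1 := by
      rw [← div_eq_mul_inv]
      exact div_le_one_of_le₀ hED (by positivity)
    have e5 : 0 ≤ c * A := by positivity
    rw [e3]
    calc 4 * (c * A) ^ 2 * (E * (D ^ (2 * s + 2))⁻¹) ≤ 4 * (1 / 4) ^ 2 * 1 := by gcongr
      _ = 1 / 4 := by norm_num
  have hmain := le_privateMinimaxRisk_of_wavelets.{u} hMRA hmother (s := s) hp hq hA' hψm hψi hB
    hR hψR (by simpa using hmom 0 N.zero_le) hbm hbi hb0 hb1 hbT hbc₀ hT hbJ (m := 2 ^ i) (j := j)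
    (γ := γ) hγ0 (by
      rw [hQ, ← mul_assoc, hγQ]
      calc c * D ^ (-s) * B = c * B * D ^ (-s) := by ring
        _ ≤ c * B * 1 := by gcongr
        _ ≤ c₀ := by linarith) (fun l x hx => by
      simp only [cell, Set.mem_ofPred_eq, hDz] at hx
      have h1 : |D * x| ≤ 3 * R * l + R := by
        have h2 := abs_sub_abs_le_abs_sub (D * x) (spacedShift R l : ℝ)
        have h3 : |(spacedShift R l : ℝ)| = 3 * R * l := by
          rw [spacedShift]
          push_cast
          exact abs_of_nonneg (by positivity)
        linarith
      have h4 : ((l : ℕ) : ℝ) + 1 ≤ v := by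
        rw [hv]
        exact_mod_cast l.2
      rw [abs_mul, abs_of_pos hD0, hDv] at h1
      rw [div_lt_iff₀ hT] at hJ
      have hR1 : (1 : ℝ) ≤ R := by exact_mod_cast hR
      have h6 : 3 * R * (l + 1) ≤ 3 * R * v := by gcongr
      have h7 : v * (6 * R) ≤ v * (K * T) := by gcongr
      have h5 : v * K * |x| ≤ v * K * (T / 2) := by linarith
      exact le_of_mul_le_mul_left h5 (by positivity)) (by
      have ht0 : 0 ≤ p.toReal⁻¹ := by positivity
      have h1 : (2 : ℝ) ^ ((j : ℝ) * (s + 1 / 2 - p.toReal⁻¹)) =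
          D ^ (s + 1 / 2 - p.toReal⁻¹) := by
        rw [hD, ← Real.rpow_natCast, ← Real.rpow_mul zero_le_two]
      have h2 : (((2 ^ i : ℕ) : ℝ≥0∞)) ^ p.toReal⁻¹ ≤ ENNReal.ofReal (D ^ p.toReal⁻¹) := by
        rw [← ENNReal.ofReal_rpow_of_nonneg hD0.le ht0, ← ENNReal.ofReal_natCast]
        gcongr
        push_cast
        exact hvD
      refine (mul_le_mul_right h2 _).trans ?_
      rw [h1, ← ENNReal.ofReal_mul (by positivity)]
      refine ENNReal.ofReal_le_ofReal (le_trans (le_of_eq ?_) hcc₁)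
      -- The `p`-th root of the number of wavelets cancels the factor `D^{-1/p}` in the weight,
      -- leaving `c` for every `p`, including infinity.
      have h3 : D ^ (s + 1 / 2 - p.toReal⁻¹) * D ^ (-(s + 1 / 2)) * D ^ p.toReal⁻¹ = 1 := by
        rw [← Real.rpow_add hD0, ← Real.rpow_add hD0, ← Real.rpow_zero D]
        congr 1
        ring
      linear_combination c * h3) hα (n := n) hr
    ⟨_, hδ0⟩ (by rw [hQ, hDz]; exact le_rfl) (one_add_sq_pow_le_two hδn)
  rw [hQ, hDz, hγQ, ← ENNReal.ofReal_natCast, ← ENNReal.ofReal_mul (by positivity)] at hmain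
  -- The number of cells times their scale is `v D⁻¹ = K⁻¹`, so only `(c D^{-s})^r` decays;
  -- replacing `v` by `2y` costs `2^{-sr}`.
  have hfin : 4 * (c ^ r * K ^ (-(s * r)) * K⁻¹ * W * 2 ^ (-(s * r)) / 4 *
      E ^ (-(r * s / (2 * s + 2)))) ≤ ((2 ^ i : ℕ) : ℝ) * ((c * D ^ (-s)) ^ r * (D⁻¹ * W)) := by
    have e1 : E ^ (-(r * s / (2 * s + 2))) = y ^ (-(s * r)) := by
      rw [hy, ← Real.rpow_mul hE0.le]
      congr 1
      field_simp
    have e2 : (c * D ^ (-s)) ^ r = c ^ r * (v ^ (-(s * r)) * K ^ (-(s * r))) := by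
      rw [Real.mul_rpow hc0.le (by positivity), ← Real.rpow_mul hD0.le, hDv, ← neg_mul,
        Real.mul_rpow hv0.le hK0.le]
    have e3 : 2 ^ (-(s * r)) * y ^ (-(s * r)) ≤ v ^ (-(s * r)) := by
      rw [← Real.mul_rpow zero_le_two (by linarith)]
      exact Real.rpow_le_rpow_of_nonpos hv0 hi2 (by
        have : 0 ≤ s * r := by positivity
        linarith)
    have e4 : ((2 ^ i : ℕ) : ℝ) = v := by push_cast; rfl
    rw [e1, e2, e4]
    calc _ = c ^ r * K ^ (-(s * r)) * K⁻¹ * W * (2 ^ (-(s * r)) * y ^ (-(s * r))) := by ring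
      _ ≤ c ^ r * K ^ (-(s * r)) * K⁻¹ * W * v ^ (-(s * r)) := by gcongr
      _ = _ := by rw [hDv]; field_simp
  have h4 := (ENNReal.ofReal_le_ofReal hfin).trans hmain
  rw [ENNReal.ofReal_mul zero_le_four, show ENNReal.ofReal 4 = 4 by simp] at h4
  exact (ENNReal.mul_le_mul_iff_right (by simp) (by simp)).1 h4

/-! ### Reduction to a bounded measurable wavelet -/

theorem FatherRegular.bounded_integrable {φ : ℝ → ℝ} {N : ℕ} (h : FatherRegular φ N)
    (hφ : MemLp φ 2 volume) : (∃ A, ∀ x, |φ x| ≤ A) ∧ Integrable φ := by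
  obtain ⟨Φ, hanti, -, hle, hint, -⟩ := h.decay
  refine ⟨⟨Φ 0, fun x => (hle x).trans (hanti (Set.mem_Ici.2 le_rfl)
    (Set.mem_Ici.2 (abs_nonneg x)) (abs_nonneg x))⟩, hint.mono' hφ.1
    (Filter.Eventually.of_forall hle)⟩

theorem IsMotherWavelet.congr_ae {φ ψ ψ' : ℝ → ℝ} {hφ : MemLp φ 2 volume}
    {hψ : MemLp ψ 2 volume} (h : IsMotherWavelet φ ψ hφ hψ) (hae : ψ =ᵐ[volume] ψ')
    (hψ' : MemLp ψ' 2 volume) : IsMotherWavelet φ ψ' hφ hψ' := by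
  have e : ∀ j, dyadicL2 ψ' hψ' j = dyadicL2 ψ hψ j := fun j =>
    funext fun k => dyadicL2_congr _ _ hae.symm j k
  exact ⟨e 0 ▸ h.orthonormal, by rw [← h.span_eq, levelSpace, levelSpace, e 0]⟩

theorem IsMotherWavelet.not_ae_eq_zero {φ ψ : ℝ → ℝ} {hφ : MemLp φ 2 volume}
    {hψ : MemLp ψ 2 volume} (h : IsMotherWavelet φ ψ hφ hψ) : ¬ ψ =ᵐ[volume] 0 := by
  intro h0
  have h1 := h.integral_mul_self_level 0 0 0
  rw [if_pos rfl, integral_eq_zero_of_ae] at h1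
  · exact zero_ne_one h1
  · filter_upwards [dyadic_congr_ae h0 0 0] with x hx
    rw [hx]
    simp [dyadic]

/-- Wavelet coefficients and the mother wavelet property see `ψ` only up to null sets, so the
essential bound may be made pointwise without changing the class of densities. -/
theorem exists_bounded_measurable_version {ψ : ℝ → ℝ} (hψ : AEStronglyMeasurable ψ volume)
    {B R : ℝ} (hB0 : 0 ≤ B) (hB : ∀ᵐ x, |ψ x| ≤ B) (hR : ∀ x, R < |x| → ψ x = 0) :
    ∃ ψ' : ℝ → ℝ, Measurable ψ' ∧ ψ =ᵐ[volume] ψ' ∧ (∀ x, |ψ' x| ≤ B) ∧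
      ∀ x, R < |x| → ψ' x = 0 := by
  refine ⟨(Set.Icc (-R) R).indicator fun x => max (-B) (min B (hψ.mk ψ x)),
    (measurable_const.max (measurable_const.min
      hψ.stronglyMeasurable_mk.measurable)).indicator measurableSet_Icc, ?_, fun x => ?_,
    fun x hx => Set.indicator_of_notMem (fun h => ?_) _⟩
  · filter_upwards [hψ.ae_eq_mk, hB] with x hx hxB
    by_cases hxR : x ∈ Set.Icc (-R) R
    · rw [Set.indicator_of_mem hxR, ← hx, min_eq_right (abs_le.1 hxB).2,
        max_eq_right (abs_le.1 hxB).1]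
    · rw [Set.indicator_of_notMem hxR, hR x]
      rw [Set.mem_Icc, ← abs_le] at hxR
      exact not_le.1 hxR
  · by_cases hxR : x ∈ Set.Icc (-R) R
    · rw [Set.indicator_of_mem hxR, abs_le]
      exact ⟨le_max_left _ _, max_le (by linarith) (min_le_left _ _)⟩
    · rw [Set.indicator_of_notMem hxR, abs_zero]
      exact hB0
  · rw [Set.mem_Icc, ← abs_le] at h
    linarith

theorem proposition2p1 (φ ψ : ℝ → ℝ) (hφ : MemLp φ 2 volume) (hψ : MemLp ψ 2 volume)
    (hMRA : GeneratesMRA φ hφ) (hmother : IsMotherWavelet φ ψ hφ hψ)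
    (N : ℕ) (hreg : FatherRegular φ N) (hsupp : HasCompactSupport ψ)
    (s : ℝ) (hs : 0 < s) (hsN : s < N + 1)
    (p q : ℝ≥0∞) (hp : 1 ≤ p) (hq : 1 ≤ q) (r : ℝ) (hr : 1 ≤ r)
    (L T : ℝ) (hL : 0 < L) (hT : 0 < T)
    (hne : ∃ L' < L, (densityBesov φ ψ s p q L' T).Nonempty) :
    ∃ C : ℝ, 0 < C ∧ ∀ α : ℝ, 0 < α → ∀ n : ℕ, 1 ≤ n * (Real.exp α - 1) ^ 2 →
      ENNReal.ofReal (C * (n * (Real.exp α - 1) ^ 2) ^ (-(r * s / (2 * s + 2)))) ≤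
        privateMinimaxRisk.{u} α n r (densityBesov φ ψ s p q L T) := by
  obtain ⟨⟨A, hA⟩, hφi⟩ := hreg.bounded_integrable hφ
  obtain ⟨G, hG, B₀, hB₀⟩ := hreg.weakDeriv
  obtain ⟨K, hK⟩ := abs_integral_mul_iteratedDeriv_le hMRA hmother hG hB₀
  obtain ⟨R₀, hR₀⟩ := hsupp.isCompact.isBounded.subset_closedBall 0
  -- A positive natural radius, so that the spaced shifts are distinct integers.
  set R : ℕ := ⌈R₀⌉₊ + 1
  have hR1 : 1 ≤ R := Nat.le_add_left 1 _
  have hψR : ∀ x : ℝ, R < |x| → ψ x = 0 := by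
    intro x hx
    by_contra hne
    have h1 := hR₀ (subset_tsupport _ hne)
    rw [mem_closedBall_zero_iff, Real.norm_eq_abs] at h1
    have h2 := Nat.le_ceil R₀
    simp only [R] at hx
    push_cast at hx
    linarith
  have hψi : Integrable ψ := by
    rw [← integrableOn_iff_integrable_of_support_subset (subset_tsupport ψ)]
    exact (hψ.locallyIntegrable one_le_two).integrableOn_isCompact hsupp.isCompact
  have hψne := hmother.not_ae_eq_zero
  obtain ⟨B, hB⟩ := exists_ae_bound_of_weak_bound hψi.locallyIntegrable R.cast_nonneg hψR hK
  have horth : ∀ j k : ℤ, 1 ≤ j → ∫ x, ψ x * ψ ((2 : ℝ) ^ j * x - k) = 0 := by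
    intro j k hj
    have h1 := hmother.integral_mul_of_ne hMRA (show (0 : ℤ) ≠ j by omega) 0 k
    have h2 : ∀ x, dyadic ψ 0 0 x * dyadic ψ j k x =
        (2 : ℝ) ^ ((j : ℝ) / 2) * (ψ x * ψ ((2 : ℝ) ^ j * x - k)) := by
      intro x
      simp only [dyadic, Int.cast_zero, zero_div, Real.rpow_zero, zpow_zero, one_mul, sub_zero]
      ring
    simp_rw [h2] at h1
    rw [integral_const_mul, mul_eq_zero] at h1
    exact h1.resolve_left (by positivity)
  have hmom : ∀ l ≤ N, ∫ y, y ^ l * ψ y = 0 := fun l hl =>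
    moment_eq_zero hψi R.cast_nonneg hψR hK horth hψne hl
  obtain ⟨ψ', hm, hae, hB', hR'⟩ := exists_bounded_measurable_version hψ.1 (le_max_right B 0)
    (hB.mono fun x hx => hx.trans (le_max_left B 0)) hψR
  have hψ' : MemLp ψ' 2 volume := hψ.ae_eq hae
  have hD : ∀ L, densityBesov φ ψ s p q L T = densityBesov φ ψ' s p q L T := fun L => by
    simp only [densityBesov, besovNorm_congr_ae_wavelet hae]
  simp only [hD] at hne ⊢
  refine exists_private_lower_bound_of_moments hMRA (hmother.congr_ae hae hψ') hs hsN hp hq hφi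
    (Filter.Eventually.of_forall hA) hm hB' hR1 hR' (hψi.congr hae)
    (fun h => hψne (hae.trans h)) (fun l hl => ?_) hr hL hT hne
  rw [← hmom l hl]
  refine integral_congr_ae ?_
  filter_upwards [hae] with x hx
  rw [hx]

end
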